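/- **Setting.** Let $(\Omega,\mathcal F,\mathbb P)$ be a complete probability space, $\delta,\beta>0$, and let $\tilde v$ be a random variable with values in $\{0,1\}$ and $\mathbb P(\tilde v=0)\in(0,1)$. Let $Z=Z^B-Z^S$, where $Z^B/\delta$ and $Z^S/\delta$ are independent Poisson processes on $[0,1]$ with intensity $\beta$, jointly independent of $\tilde v$. For a process $U$, $(\mathcal F^U_t)_{t\in[0,1]}$ denotes the minimal filtration generated by $U$ satisfying the usual conditions. *Pricing rules.* A pricing rule is a function $p:\delta\mathbb Z\times[0,1]\to[0,1]$ such that $y\mapsto p(y,t)$ is strictly increasing for each $t\in[0,1)$ and $t\mapsto p(y,t)$ is continuously differentiable on $[0,1]$ for each $y\in\delta\mathbb Z$. For $z\in\delta\mathbb Z$ put $p^z(y,t)=\mathbb E[\mathbf 1_{\{Z_1\ge z\}}\mid Z_t=y]$ (for $t=0$ and $y\neq0$ this is understood through the transition probabilities of the Markov process $Z$, i.e. as $\mathbb P(y+Z_1-Z_0\ge z)$). *Admissible strategies.* $(X^B,X^S;\mathcal F^I)$ is admissible if (a) $\mathcal F^I$ is a filtration satisfying the usual conditions with $\mathcal F^I_t=\sigma(\tilde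 v,\mathcal F^Z_t,\mathcal H_t)$ for all $t\in[0,1]$, where $\mathcal H$ is a filtration independent of $(\tilde v,\mathcal F^Z)$; (b) $X^B,X^S$ are $\mathcal F^I$-adapted increasing point processes with jump size $\delta$, null at $0$, with $\mathbb E[X^B_1],\mathbb E[X^S_1]<\infty$; (c) the $(\mathcal F^I,\mathbb P)$-dual predictable projections of $X^B$ and $X^S$ are absolutely continuous in time; (d) almost surely $X^B$ and $X^S$ never jump at the same time. *Profit.* Let $Y=Z+X^B-X^S$. Write $X^B=X^{B,B}+X^{B,T}+X^{B,S}$, where $X^{B,B}$, $X^{B,T}$, $X^{B,S}$ collect the jumps of $X^B$ that occur, respectively, at times at which neither $Z^B$ nor $Z^S$ jumps, at jump times of $Z^B$, and at jump times of $Z^S$; likewise $X^S=X^{S,S}+X^{S,T}+X^{S,B}$, where $X^{S,S}$, $X^{S,T}$, $X^{S,B}$ collect the jumps of $X^S$ at times at which neither $Z^B$ nor $Z^S$ jumps, at jump times of $Z^S$, and at jump times of $Z^B$. The conditional expected profit of the insider is $$\mathbb E\Big[\int_0^1(\tilde v-p(Y_{t-}+\delta,t))\,dX^{B,B}_t+\int_0^1(\tilde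 v-p(Y_{t-}+2\delta,t))\,dX^{B,T}_t+\int_0^1(\tilde v-p(Y_{t-},t))\,dX^{B,S}_t$$ $$-\int_0^1(\tilde v-p(Y_{t-}-\delta,t))\,dX^{S,S}_t-\int_0^1(\tilde v-p(Y_{t-}-2\delta,t))\,dX^{S,T}_t-\int_0^1(\tilde v-p(Y_{t-},t))\,dX^{S,B}_t\ \Big|\ \tilde v\Big].$$ *Equilibrium.* $(p,X^B,X^S,\mathcal F^I)$ is a Glosten–Milgrom equilibrium if (1) $p$ is a pricing rule with $p(Y_t,t)=\mathbb E[\tilde v\mid\mathcal F^Y_t]$ a.s. for every $t\in[0,1]$, and (2) $(X^B,X^S;\mathcal F^I)$ is admissible and, for the given $p$, the profits of all admissible strategies are integrable and $(X^B,X^S;\mathcal F^I)$ almost surely maximises the conditional expected profit among all admissible strategies (with arbitrary admissible insider filtrations). **Theorem.** $(p,X^B,X^S,\mathcal F^I)$ is a Glosten–Milgrom equilibrium if there exists $y_\delta\in\delta\mathbb Z$ such that 1. $[Y_1\ge y_\delta]=[\tilde v=1]$ $\mathbb P$-a.s.; 2. $p=p^{y_\delta}$ on $\delta\mathbb Z\times[0,1]$;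 3. $(X^B,X^S;\mathcal F^I)$ is an admissible strategy such that $Y=Z+X^B-X^S=Y^B-Y^S$ a.s., where $Y^B/\delta$ and $Y^S/\delta$ are independent, $\mathcal F^Y$-adapted Poisson processes with common intensity $\beta$, and a.s. $X^S\equiv0$ on $[\tilde v=1]$ and $X^B\equiv0$ on $[\tilde v=0]$. -/

import Mathlib

open MeasureTheory ProbabilityTheory Set Filter Topology unitInterval
open scoped NNReal ENNReal

namespace GlostenMilgrom

noncomputable section

/-! ### Paths on the time interval `[0,1]`

Time is `I = [0,1]`.  `Function.leftLim f t` is the left limit `f(t-)`; at `t = 0` it is `f 0`, so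
that a path has no jump at time `0`. -/

/-- The jump `Δf(t) = f(t) - f(t-)`. -/
def jump (f : I → ℝ) (t : I) : ℝ := f t - Function.leftLim f t

/-- `f` is a path of a point process with jump size `δ`: it starts at `0`, is nondecreasing and
right-continuous, takes values in `{0, δ, 2δ, …}`, and each of its jumps has size `δ`. -/
structure IsPointPath (δ : ℝ) (f : I → ℝ) : Prop where
  zero : f 0 = 0
  mono : Monotone f
  rightCts : ∀ t, ContinuousWithinAt f (Ici t) t
  values : ∀ t, ∃ n : ℕ, f t = δ * n
  jumps : ∀ t, jump f t = 0 ∨ jump f t = δ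

/-- `∫_S h(t) dx(t)` for a path `x` that moves only by finitely many jumps, and a set `S` of
times. -/
def jumpIntegral (S : Set I) (h x : I → ℝ) : ℝ :=
  ∑ᶠ t ∈ S, h t * jump x t

/-! ### Processes and filtrations -/

variable {Ω : Type*} {m : MeasurableSpace Ω}

/-- A Poisson process with constant intensity `β` on the time interval `[0,1]`. -/
structure IsPoissonProcess (μ : Measure Ω) (β : ℝ≥0) (N : I → Ω → ℝ) : Prop where
  measurable : ∀ t, Measurable (N t)
  path : ∀ᵐ ω ∂μ, IsPointPath 1 (fun t => N t ω)
  indep : HasIndepIncrements N μ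
  law : ∀ s t : I, s ≤ t →
    μ.map (fun ω => N t ω - N s ω) =
      (poissonMeasure (β * Real.toNNReal ((t : ℝ) - s))).map (Nat.cast : ℕ → ℝ)

/-- Independence of two real processes (for the product σ-algebras on their path spaces). -/
def IndepProcesses (μ : Measure Ω) (N M : I → Ω → ℝ) : Prop :=
  IndepFun (fun ω t => N t ω) (fun ω t => M t ω) μ

/-- The usual conditions: right-continuity, and `F 0` contains all null sets. -/
structure UsualConditions (μ : Measure Ω) (F : Filtration I m) : Prop where
  rightCts : F.IsRightContinuous
  complete : ∀ s : Set Ω, μ s = 0 → MeasurableSet[F 0] s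

/-- The filtration generated by the process `Y` and the `μ`-null sets. -/
def completedNatural (μ : Measure Ω) (Y : I → Ω → ℝ) : Filtration I m where
  seq t := MeasurableSpace.generateFrom
    {s | MeasurableSet[m] s ∧ (μ s = 0 ∨ ∃ u ≤ t, ∃ B : Set ℝ, MeasurableSet B ∧ Y u ⁻¹' B = s)}
  mono' _ _ hst := MeasurableSpace.generateFrom_mono fun _ hs =>
    ⟨hs.1, hs.2.imp_right fun ⟨u, hu, h⟩ => ⟨u, hu.trans hst, h⟩⟩
  le' _ := MeasurableSpace.generateFrom_le fun _ hs => hs.1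

/-- The minimal filtration generated by `Y` that satisfies the usual conditions: the
right-continuous augmentation of the filtration generated by `Y` with the `μ`-null sets. -/
def generatedFiltration (μ : Measure Ω) (Y : I → Ω → ℝ) : Filtration I m :=
  (completedNatural μ Y).rightCont

/-- `A` is the `(F, μ)`-dual predictable projection (predictable compensator) of the integrable
increasing process `X`: the integrable predictable increasing right-continuous process, null at
`0`, for which `X - A` is an `F`-martingale. -/
structure IsDualPredictableProjection (μ : Measure Ω) (F : Filtration I m)
    (X A : I → Ω → ℝ) : Prop where
  predictable : IsStronglyPredictable F A
  zero : ∀ᵐ ω ∂μ, A 0 ω = 0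
  mono : ∀ᵐ ω ∂μ, Monotone (fun t => A t ω)
  rightCts : ∀ᵐ ω ∂μ, ∀ t, ContinuousWithinAt (fun s => A s ω) (Ici t) t
  integrable : Integrable (A 1) μ
  martingale : Martingale (fun t ω => X t ω - A t ω) F μ

/-! ### The market -/

/-- The data of the market: trade size `δ > 0`, noise intensity `β > 0`, a fundamental value `v`
with values in `{0,1}` that is really random, and cumulative noise buys `ZB` and sells `ZS` such
that `ZB/δ` and `ZS/δ` are independent Poisson processes of intensity `β`, independent of `v`. -/
structure IsMarket (μ : Measure Ω) (δ : ℝ) (β : ℝ≥0) (v : Ω → ℝ) (ZB ZS : I → Ω → ℝ) : Prop where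
  delta_pos : 0 < δ
  beta_pos : 0 < β
  measurable_v : Measurable v
  values_v : ∀ ω, v ω = 0 ∨ v ω = 1
  pos : 0 < μ {ω | v ω = 0}
  lt_one : μ {ω | v ω = 0} < 1
  poisson_buy : IsPoissonProcess μ β (fun t ω => ZB t ω / δ)
  poisson_sell : IsPoissonProcess μ β (fun t ω => ZS t ω / δ)
  indep_noise : IndepProcesses μ ZB ZS
  indep_v : IndepFun (fun ω => ((fun t => ZB t ω), (fun t => ZS t ω))) v μ

/-- The net noise demand `Z = ZB - ZS`. -/
def netNoise (ZB ZS : I → Ω → ℝ) (t : I) (ω : Ω) : ℝ := ZB t ω - ZS t ω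

/-- The total net demand `Y = Z + XB - XS`. -/
def totalDemand (ZB ZS XB XS : I → Ω → ℝ) (t : I) (ω : Ω) : ℝ :=
  netNoise ZB ZS t ω + XB t ω - XS t ω

/-- The lattice `δℤ`. -/
def lattice (δ : ℝ) : Set ℝ := {y | ∃ k : ℤ, y = δ * k}

/-- Pricing rules `p : δℤ × [0,1] → [0,1]`.  Only the values of `p` on the lattice matter. -/
structure IsPricingRule (δ : ℝ) (p : ℝ → I → ℝ) : Prop where
  mem_Icc : ∀ y ∈ lattice δ, ∀ t, p y t ∈ Icc (0 : ℝ) 1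
  strictMono : ∀ t : I, t < 1 → StrictMonoOn (fun y => p y t) (lattice δ)
  contDiff : ∀ y ∈ lattice δ,
    ContDiffOn ℝ 1 (IccExtend zero_le_one (p y)) (Icc (0 : ℝ) 1)

/-- The function `P^z(y)`, equal to `0` for `y < z` and to `1` for `y ≥ z`. -/
def terminalPrice (z y : ℝ) : ℝ := if z ≤ y then 1 else 0

open scoped Classical in
/-- `p^z(y,t) = E[P^z(Z_1) | Z_t = y]`.  For `t > 0` the event `Z_t = y`, `y ∈ δℤ`, has positive
probability and this is the elementary conditional expectation.  Where that event is null (on the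
lattice: only for `t = 0`, `y ≠ 0`) the conditional law of `Z_1` is understood, as usual for a
Markov process, through the transition probabilities: it is the law of `y + Z_1 - Z_t`. -/
def markovPrice (μ : Measure Ω) (Z : I → Ω → ℝ) (z y : ℝ) (t : I) : ℝ :=
  if μ {ω | Z t ω = y} = 0 then ∫ ω, terminalPrice z (y + (Z 1 ω - Z t ω)) ∂μ
  else ∫ ω, terminalPrice z (Z 1 ω) ∂(ProbabilityTheory.cond μ {ω | Z t ω = y})

/-! ### Strategies of the insider -/

/-- `F` is an insider filtration: it satisfies the usual conditions and
`F_t = σ(v, F^Z_t, H_t)` for a filtration `H` that is independent of `(v, F^Z)`. -/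
structure IsInsiderFiltration (μ : Measure Ω) (v : Ω → ℝ) (Z : I → Ω → ℝ)
    (F : Filtration I m) : Prop where
  usual : UsualConditions μ F
  generated : ∃ H : Filtration I m,
    Indep (H 1) (MeasurableSpace.comap v inferInstance ⊔ generatedFiltration μ Z 1) μ ∧
    ∀ t, F t = MeasurableSpace.comap v inferInstance ⊔ generatedFiltration μ Z t ⊔ H t

/-- `X` is a process of cumulative orders admissible on one side of the market: an `F`-adapted
integrable increasing point process with jump size `δ` whose `(F, μ)`-dual predictable projection
is absolutely continuous in time. -/
structure IsOrderProcess (μ : Measure Ω) (δ : ℝ) (F : Filtration I m) (X : I → Ω → ℝ) :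
    Prop where
  adapted : StronglyAdapted F X
  path : ∀ᵐ ω ∂μ, IsPointPath δ (fun t => X t ω)
  integrable : Integrable (X 1) μ
  compensator : ∃ A : I → Ω → ℝ, IsDualPredictableProjection μ F X A ∧
    ∀ᵐ ω ∂μ, AbsolutelyContinuousOnInterval (IccExtend zero_le_one (fun t => A t ω)) 0 1

/-- Admissible strategies `(XB, XS; F)`.  The insider never places two opposite orders at the same
time. -/
structure IsAdmissible (μ : Measure Ω) (δ : ℝ) (v : Ω → ℝ) (ZB ZS : I → Ω → ℝ)
    (XB XS : I → Ω → ℝ) (F : Filtration I m) : Prop where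
  filtration : IsInsiderFiltration μ v (netNoise ZB ZS) F
  buy : IsOrderProcess μ δ F XB
  sell : IsOrderProcess μ δ F XS
  no_opposite : ∀ᵐ ω ∂μ, ∀ t, jump (fun s => XB s ω) t = 0 ∨ jump (fun s => XS s ω) t = 0

/-- The times at which no noise order arrives. -/
def quietTimes (ZB ZS : I → Ω → ℝ) (ω : Ω) : Set I :=
  {t | jump (fun s => ZB s ω) t = 0 ∧ jump (fun s => ZS s ω) t = 0}

/-- The jump times of a path. -/
def jumpTimes (Z : I → Ω → ℝ) (ω : Ω) : Set I := {t | jump (fun s => Z s ω) t ≠ 0}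

/-- The profit of the insider at time `1`.  Her buys `XB` split into those that arrive at times
without noise orders (traded at the ask `p(Y_{t-}+δ,t)`), those that arrive together with a noise
buy (traded at `p(Y_{t-}+2δ,t)`) and those that cancel a noise sell (traded at `p(Y_{t-},t)`); her
sells `XS` split in the same way. -/
def profit (δ : ℝ) (v : Ω → ℝ) (ZB ZS : I → Ω → ℝ) (p : ℝ → I → ℝ)
    (XB XS : I → Ω → ℝ) (ω : Ω) : ℝ :=
  let y : I → ℝ := fun t => Function.leftLim (fun s => totalDemand ZB ZS XB XS s ω) t
  let xB : I → ℝ := fun t => XB t ω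
  let xS : I → ℝ := fun t => XS t ω
  jumpIntegral (quietTimes ZB ZS ω) (fun t => v ω - p (y t + δ) t) xB
  + jumpIntegral (jumpTimes ZB ω) (fun t => v ω - p (y t + 2 * δ) t) xB
  + jumpIntegral (jumpTimes ZS ω) (fun t => v ω - p (y t) t) xB
  - jumpIntegral (quietTimes ZB ZS ω) (fun t => v ω - p (y t - δ) t) xS
  - jumpIntegral (jumpTimes ZS ω) (fun t => v ω - p (y t - 2 * δ) t) xS
  - jumpIntegral (jumpTimes ZB ω) (fun t => v ω - p (y t) t) xS

/-- The expected profit of the insider conditional on `v`. -/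
def expectedProfit (μ : Measure Ω) (δ : ℝ) (v : Ω → ℝ) (ZB ZS : I → Ω → ℝ) (p : ℝ → I → ℝ)
    (XB XS : I → Ω → ℝ) : Ω → ℝ :=
  μ[profit δ v ZB ZS p XB XS | MeasurableSpace.comap v inferInstance]

/-! ### Equilibrium -/

/-- Given the strategy, `p` is a rational pricing rule: `p(Y_t,t) = E[v | F^Y_t]` for all `t`. -/
structure IsRationalPricingRule (μ : Measure Ω) (δ : ℝ) (v : Ω → ℝ) (ZB ZS : I → Ω → ℝ)
    (p : ℝ → I → ℝ) (XB XS : I → Ω → ℝ) : Prop where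
  pricingRule : IsPricingRule δ p
  rational : ∀ t : I, (fun ω => p (totalDemand ZB ZS XB XS t ω) t) =ᵐ[μ]
    μ[v | generatedFiltration μ (totalDemand ZB ZS XB XS) t]

/-- Given `p`, the strategy is admissible and maximises the expected profit conditional on `v`
among all admissible strategies (whatever their filtration); all profits are integrable. -/
structure IsOptimalStrategy (μ : Measure Ω) (δ : ℝ) (v : Ω → ℝ) (ZB ZS : I → Ω → ℝ)
    (p : ℝ → I → ℝ) (XB XS : I → Ω → ℝ) (F : Filtration I m) : Prop where
  admissible : IsAdmissible μ δ v ZB ZS XB XS F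
  integrable : Integrable (profit δ v ZB ZS p XB XS) μ
  optimal : ∀ (XB' XS' : I → Ω → ℝ) (F' : Filtration I m),
    IsAdmissible μ δ v ZB ZS XB' XS' F' →
      Integrable (profit δ v ZB ZS p XB' XS') μ ∧
      expectedProfit μ δ v ZB ZS p XB' XS' ≤ᵐ[μ] expectedProfit μ δ v ZB ZS p XB XS

/-- `(p, XB, XS, F)` is a Glosten–Milgrom equilibrium. -/
structure IsEquilibrium (μ : Measure Ω) (δ : ℝ) (v : Ω → ℝ) (ZB ZS : I → Ω → ℝ)
    (p : ℝ → I → ℝ) (XB XS : I → Ω → ℝ) (F : Filtration I m) : Prop where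
  rational : IsRationalPricingRule μ δ v ZB ZS p XB XS
  optimal : IsOptimalStrategy μ δ v ZB ZS p XB XS F

end

end GlostenMilgrom

/-!
The price `p(y,t) = P(y + Z_1 - Z_t ≥ z)` of a difference `Z` of independent Poisson processes is a
tail probability of the difference of two Poisson variables with parameter `β (1 - t)`
(`IsPoissonDifference.markovPrice_eq`). As a function of that parameter it is an exponential times an
entire power series, and the difference charges every integer, which makes `p` a pricing rule
(`isPricingRule_of_eq_poissonPrice`).

*Rationality.* The increments of `Y` after time `t` are independent of the right-continuous
augmentation of its past (`IsPoissonDifference.indep_generatedFiltration`), and `v` is almost surely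
the indicator of `Y_1 ≥ z`; so `E[v | F^Y_t] = p(Y_t,t)`
(`IsPoissonDifference.price_ae_eq_condExp`).

*Optimality.* No stochastic calculus is needed. In each of the six parts of the profit the order
trades at the price *after* the trade, so that the profit is `∫ (v - p(Y_t,t)) dX_t` with
`X = XB - XS` (`profit_eq_jumpIntegral`); this uses that the independent processes `ZB` and `ZS`
almost surely have no common jump (`ae_no_common_jump`). The integral is a limit of Riemann sums over
the grids of mesh `1/n`, dominated by `XB_1 + XS_1`. At a grid point `u` the future noise `Z_1 - Z_u`
is independent of the insider's information, so in expectation, even conditionally on `v`, the price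
`p(Y_u,u)` may be replaced by the indicator of `Y_u + Z_1 - Z_u = Z_1 + X_u ≥ z`
(`setIntegral_gridProfit`). After that replacement the problem is deterministic for each outcome: with
the final noise `c = Z_1` fixed, the integrand `v - 1{c + x ≥ z}` is, on the lattice,
minus a subgradient at `x` of a convex function `G` of the position, namely `(z - δ - c - x)⁺` if
`v = 1` and `(c + x - z)⁺` if `v = 0`. Telescoping, every Riemann sum is at most `G(0)` (`gridSum_le_foresightProfit`), whatever the
strategy. If the insider only buys for `v = 1`, only sells for `v = 0`, and ends with `Y_1 ≥ z` exactly
if `v = 1`, then her unit trades pass through the levels of the position one by one and the bound is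
attained in the limit (`tendsto_gridForesight`).
-/

namespace GlostenMilgrom

/-! ### Point paths and their jumps -/

lemma nhdsLT_neBot_of_pos {t : I} (ht : 0 < t) : (𝓝[<] t).NeBot :=
  nhdsLT_neBot_of_exists_lt ⟨0, ht⟩

lemma jump_zero (f : I → ℝ) : jump f 0 = 0 := by
  rw [jump, leftLim_eq_of_isBot (a := (0 : I)) (fun t => t.2.1), sub_self]

/-- A point path only has finitely many jumps, it is the sum of them, and it passes through the
levels `δ, 2δ, …, x 1` one after the other. -/
lemma IsPointPath.exists_jumps {δ : ℝ} (hδ : 0 < δ) {x : I → ℝ} (hx : IsPointPath δ x) :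
    ∃ J : Finset I, (∀ t ∈ J, 0 < t) ∧ (∀ t, jump x t = if t ∈ J then δ else 0) ∧
      (∀ t, x t = ∑ s ∈ J, if s ≤ t then δ else 0) ∧
      ∃ N : ℕ, x 1 = δ * N ∧
        ∀ h : ℝ → ℝ, ∑ t ∈ J, h (x t) = ∑ k ∈ Finset.range N, h (δ * (k + 1)) := by
  classical
  obtain ⟨N, hN⟩ := hx.values 1
  -- the first time at which the level `δ * (k + 1)` is reached
  let τ : ℕ → I := fun k => sInf {t | δ * (k + 1) ≤ x t}
  have hle : ∀ {k : ℕ}, k < N → ∀ t, τ k ≤ t ↔ δ * (k + 1) ≤ x t := by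
    intro k hk t
    have hne : ({t | δ * (k + 1) ≤ x t} : Set I).Nonempty := by
      refine ⟨1, ?_⟩
      have : (k : ℝ) + 1 ≤ N := by exact_mod_cast hk
      simpa [hN] using mul_le_mul_of_nonneg_left this hδ.le
    have hmem : δ * (k + 1) ≤ x (τ k) := by
      have h1 : τ k ∈ closure {t | δ * (k + 1) ≤ x t} := csInf_mem_closure hne (OrderBot.bddBelow _)
      have h2 : ContinuousWithinAt x {t | δ * (k + 1) ≤ x t} (τ k) :=
        (hx.rightCts (τ k)).mono fun s hs => sInf_le hs
      have h3 := h2.mem_closure h1 (t := Ici (δ * (k + 1))) (fun s hs => hs)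
      rwa [isClosed_Ici.closure_eq] at h3
    exact ⟨fun h => hmem.trans (hx.mono h), fun h => sInf_le h⟩
  have hpos : ∀ {k : ℕ}, k < N → 0 < τ k := by
    intro k hk
    rw [← not_le, hle hk, hx.zero, not_le]
    positivity
  have hjump : ∀ {k : ℕ}, k < N → jump x (τ k) = δ ∧ x (τ k) = δ * (k + 1) := by
    intro k hk
    have := nhdsLT_neBot_of_pos (hpos hk)
    have h1 : Function.leftLim x (τ k) ≤ δ * k := by
      refine le_of_tendsto (hx.mono.tendsto_leftLim _) ?_
      filter_upwards [self_mem_nhdsWithin] with s hs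
      obtain ⟨n, hn⟩ := hx.values s
      have h2 : ¬ δ * (k + 1) ≤ x s := by rw [← hle hk]; exact not_le.2 hs
      rw [hn] at h2 ⊢
      have h3 : (n : ℝ) < k + 1 := lt_of_mul_lt_mul_left (not_le.1 h2) hδ.le
      have h4 : n ≤ k := by exact_mod_cast Nat.lt_succ_iff.1 (by exact_mod_cast h3)
      have : (n : ℝ) ≤ k := by exact_mod_cast h4
      gcongr
    have h2 := (hle hk _).1 le_rfl
    have h3 : δ ≤ jump x (τ k) := by unfold jump; linarith
    have h4 : jump x (τ k) = δ := (hx.jumps _).resolve_left (by linarith)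
    refine ⟨h4, le_antisymm ?_ h2⟩
    unfold jump at h4
    linarith
  have hinj : Set.InjOn τ (Finset.range N) := by
    intro a ha b hb hab
    have h1 := (hjump (Finset.mem_range.1 ha)).2
    rw [hab, (hjump (Finset.mem_range.1 hb)).2] at h1
    have := mul_left_cancel₀ hδ.ne' h1
    exact_mod_cast (add_right_cancel this).symm
  refine ⟨(Finset.range N).image τ, ?_, ?_, ?_, N, hN, ?_⟩
  · simp only [Finset.mem_image, Finset.mem_range, forall_exists_index, and_imp]
    rintro t k hk rfl
    exact hpos hk
  · intro t
    split_ifs with ht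
    · simp only [Finset.mem_image, Finset.mem_range] at ht
      obtain ⟨k, hk, rfl⟩ := ht
      exact (hjump hk).1
    · refine (hx.jumps t).resolve_right fun hj => ht ?_
      have ht0 : 0 < t := by
        rcases eq_or_lt_of_le (show 0 ≤ t from bot_le) with h | h
        · rw [← h, jump_zero] at hj
          exact absurd hj hδ.ne
        · exact h
      obtain ⟨n, hn⟩ := hx.values t
      have h0 : 0 ≤ Function.leftLim x t := hx.zero ▸ hx.mono.le_leftLim ht0
      have hl : Function.leftLim x t = δ * n - δ := by unfold jump at hj; linarith
      have hn1 : 1 ≤ n := by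
        by_contra! hcon
        have : n = 0 := by omega
        subst this
        simp at hl
        linarith
      obtain ⟨k, rfl⟩ := Nat.exists_eq_add_of_le' hn1
      have hk : k < N := by
        have : δ * ((k + 1 : ℕ) : ℝ) ≤ δ * N := hn ▸ hN ▸ hx.mono le_top
        have := le_of_mul_le_mul_left this hδ
        exact_mod_cast this
      push_cast at hn hl
      have h1 : τ k ≤ t := (hle hk t).2 hn.ge
      refine Finset.mem_image.2 ⟨k, Finset.mem_range.2 hk, ?_⟩
      by_contra hne
      have h2 := hx.mono.le_leftLim (lt_of_le_of_ne h1 hne)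
      rw [(hjump hk).2, hl] at h2
      linarith
  · intro t
    rw [Finset.sum_image hinj]
    obtain ⟨n, hn⟩ := hx.values t
    have hnN : n ≤ N := by
      have : δ * (n : ℝ) ≤ δ * N := hn ▸ hN ▸ hx.mono le_top
      have := le_of_mul_le_mul_left this hδ
      exact_mod_cast this
    have h1 : ∀ k ∈ Finset.range N, (if τ k ≤ t then δ else 0) = if k < n then δ else 0 := by
      intro k hk
      have h2 : τ k ≤ t ↔ k < n := by
        rw [hle (Finset.mem_range.1 hk), hn, mul_le_mul_iff_right₀ hδ]
        exact_mod_cast Nat.succ_le_iff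
      simp [h2]
    have h2 : (Finset.range N).filter (· < n) = Finset.range n := by
      ext k; simp; omega
    rw [Finset.sum_congr rfl h1, ← Finset.sum_filter, h2, hn]
    simp [mul_comm]
  · intro h
    rw [Finset.sum_image hinj]
    refine Finset.sum_congr rfl fun k hk => ?_
    rw [(hjump (Finset.mem_range.1 hk)).2]

lemma IsPointPath.nonneg {δ : ℝ} {x : I → ℝ} (hx : IsPointPath δ x) (t : I) : 0 ≤ x t :=
  hx.zero ▸ hx.mono bot_le

/-- A point path is constant just after any time. -/
lemma IsPointPath.eventually_eq {δ : ℝ} (hδ : 0 < δ) {x : I → ℝ} (hx : IsPointPath δ x) (t : I) :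
    ∀ᶠ s in 𝓝[≥] t, x s = x t := by
  have h1 := (hx.rightCts t).eventually (gt_mem_nhds (show x t < x t + δ by linarith))
  filter_upwards [h1, self_mem_nhdsWithin] with s hs hts
  refine le_antisymm ?_ (hx.mono hts)
  obtain ⟨n, hn⟩ := hx.values s
  obtain ⟨k, hk⟩ := hx.values t
  rw [hn, hk] at hs ⊢
  have h2 : δ * (n : ℝ) < δ * (k + 1) := by linarith
  have h3 := lt_of_mul_lt_mul_left h2 hδ.le
  have h4 : n ≤ k := Nat.lt_succ_iff.1 (by exact_mod_cast h3)
  have : (n : ℝ) ≤ k := by exact_mod_cast h4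
  gcongr

lemma jump_div (δ : ℝ) {x : I → ℝ} (hx : Monotone x) (t : I) :
    jump (fun s => x s / δ) t = jump x t / δ := by
  rcases eq_or_lt_of_le (show 0 ≤ t from bot_le) with h | h
  · rw [← h, jump_zero, jump_zero, zero_div]
  · have := nhdsLT_neBot_of_pos h
    have h1 := (hx.tendsto_leftLim t).div_const δ
    have h2 : Function.leftLim (fun s => x s / δ) t = Function.leftLim x t / δ :=
      leftLim_eq_of_tendsto h1
    rw [jump, jump, h2, sub_div]

lemma IsPointPath.of_div {δ : ℝ} (hδ : 0 < δ) {x : I → ℝ}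
    (hx : IsPointPath 1 (fun t => x t / δ)) : IsPointPath δ x := by
  have hmono : Monotone x := fun s t hst => by
    have := hx.mono hst
    exact (div_le_div_iff_of_pos_right hδ).1 this
  refine ⟨?_, hmono, fun t => ?_, fun t => ?_, fun t => ?_⟩
  · simpa [hδ.ne'] using hx.zero
  · have := (hx.rightCts t).mul_const δ
    simpa [div_mul_cancel₀ _ hδ.ne'] using this
  · obtain ⟨n, hn⟩ := hx.values t
    refine ⟨n, ?_⟩
    rw [div_eq_iff hδ.ne'] at hn
    linarith
  · have := hx.jumps t
    rw [jump_div δ hmono, div_eq_iff hδ.ne', div_eq_iff hδ.ne'] at this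
    simpa using this

open scoped Classical in
/-- The integral against a point path as a finite sum over its jump times. -/
lemma jumpIntegral_eq_sum {δ : ℝ} {x : I → ℝ} {J : Finset I}
    (hJ : ∀ t, jump x t = if t ∈ J then δ else 0) (S : Set I) (h : I → ℝ) :
    jumpIntegral S h x = ∑ t ∈ J, if t ∈ S then h t * δ else 0 := by
  unfold jumpIntegral
  rw [finsum_mem_def, finsum_eq_sum_of_support_subset (s := J)]
  · refine Finset.sum_congr rfl fun t ht => ?_
    simp [indicator, hJ, ht]
  · intro t ht
    by_contra hcon
    apply ht
    simp only [Finset.mem_coe] at hcon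
    simp [indicator, hJ, hcon]

/-! ### Riemann sums against point paths -/

/-- The grid point `i / n` of `[0,1]`. -/
noncomputable def gridPoint (n i : ℕ) : I := projIcc 0 1 zero_le_one ((i : ℝ) / n)

/-- The Riemann sum of `f` against `x` on the grid of mesh `1 / n`, with `f` evaluated at right
endpoints. -/
noncomputable def gridSum (n : ℕ) (f x : I → ℝ) : ℝ :=
  ∑ i ∈ Finset.range n, f (gridPoint n (i + 1)) * (x (gridPoint n (i + 1)) - x (gridPoint n i))

lemma coe_gridPoint {n i : ℕ} (h : i ≤ n) : (gridPoint n i : ℝ) = i / n := by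
  have : (i : ℝ) / n ≤ 1 := div_le_one_of_le₀ (by exact_mod_cast h) (by positivity)
  unfold gridPoint
  rw [coe_projIcc]
  simp [this]
  positivity

lemma gridPoint_zero (n : ℕ) : gridPoint n 0 = 0 := by
  ext; simp [coe_gridPoint]

lemma gridPoint_self {n : ℕ} (hn : 0 < n) : gridPoint n n = 1 := by
  ext; rw [coe_gridPoint le_rfl, div_self (by positivity)]; rfl

lemma gridPoint_mono (n : ℕ) : Monotone (gridPoint n) := by
  intro i j h
  apply monotone_projIcc
  have : (i : ℝ) ≤ j := by exact_mod_cast h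
  gcongr

lemma le_gridPoint_iff {n i : ℕ} (hn : 0 < n) (hi : i ≤ n) (t : I) :
    t ≤ gridPoint n i ↔ ⌈(t : ℝ) * n⌉₊ ≤ i := by
  have : (0 : ℝ) < n := by exact_mod_cast hn
  rw [← Subtype.coe_le_coe, coe_gridPoint hi, le_div_iff₀ this, Nat.ceil_le]

lemma ceil_mul_le (n : ℕ) (t : I) : ⌈(t : ℝ) * n⌉₊ ≤ n :=
  Nat.ceil_le.2 (mul_le_of_le_one_left (by positivity) t.2.2)

/-- The first grid point after `t` tends to `t` from the right. -/
lemma tendsto_gridPoint_ceil (t : I) :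
    Tendsto (fun n : ℕ => gridPoint n ⌈(t : ℝ) * n⌉₊) atTop (𝓝[≥] t) := by
  refine tendsto_nhdsWithin_iff.2 ⟨?_, ?_⟩
  · rw [tendsto_subtype_rng]
    have h1 : Tendsto (fun n : ℕ => (t : ℝ) + 1 / n) atTop (𝓝 (t : ℝ)) := by
      simpa using tendsto_const_nhds.add (tendsto_one_div_atTop_nhds_zero_nat (𝕜 := ℝ))
    refine tendsto_of_tendsto_of_tendsto_of_le_of_le' tendsto_const_nhds h1 ?_ ?_
    · filter_upwards [eventually_gt_atTop 0] with n hn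
      exact (le_gridPoint_iff hn (ceil_mul_le n t) t).2 le_rfl
    · filter_upwards [eventually_gt_atTop 0] with n hn
      have hn' : (0 : ℝ) < n := by exact_mod_cast hn
      rw [coe_gridPoint (ceil_mul_le n t), div_le_iff₀ hn', add_mul, one_div_mul_cancel hn'.ne']
      exact (Nat.ceil_lt_add_one (mul_nonneg t.2.1 hn'.le)).le
  · filter_upwards [eventually_gt_atTop 0] with n hn
    exact (le_gridPoint_iff hn (ceil_mul_le n t) t).2 le_rfl

/-- On the grid, a unit jump at `s` picks the value of `f` at the first grid point after `s`. -/
lemma gridSum_indicator {n : ℕ} (hn : 0 < n) (f : I → ℝ) {s : I} (hs : 0 < s) (δ : ℝ) :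
    gridSum n f (fun t => if s ≤ t then δ else 0) = f (gridPoint n ⌈(s : ℝ) * n⌉₊) * δ := by
  have hpos : 0 < ⌈(s : ℝ) * n⌉₊ := by
    have : (0 : ℝ) < s := hs
    exact Nat.ceil_pos.2 (by positivity)
  obtain ⟨k, hk⟩ := Nat.exists_eq_add_of_le' hpos
  have hkn : k < n := by have := ceil_mul_le n s; omega
  unfold gridSum
  rw [Finset.sum_eq_single k]
  · beta_reduce
    rw [if_pos, if_neg, hk, sub_zero]
    · rw [le_gridPoint_iff hn (by omega)]; omega
    · rw [le_gridPoint_iff hn (by omega)]; omega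
  · intro i hi hik
    have hi := Finset.mem_range.1 hi
    have : s ≤ gridPoint n (i + 1) ↔ s ≤ gridPoint n i := by
      rw [le_gridPoint_iff hn (by omega), le_gridPoint_iff hn (by omega)]; omega
    simp [this]
  · intro h
    simp at h
    omega

lemma tendsto_gridSum {δ : ℝ} (hδ : 0 < δ) {x f : I → ℝ} (hx : IsPointPath δ x)
    (hf : ∀ t, ContinuousWithinAt f (Ici t) t) :
    Tendsto (fun n => gridSum n f x) atTop (𝓝 (jumpIntegral univ f x)) := by
  classical
  obtain ⟨J, hpos, hJ, hsum, -⟩ := hx.exists_jumps hδ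
  rw [jumpIntegral_eq_sum hJ]
  have h1 : ∀ᶠ n in atTop, ∑ s ∈ J, f (gridPoint n ⌈(s : ℝ) * n⌉₊) * δ = gridSum n f x := by
    filter_upwards [eventually_gt_atTop 0] with n hn
    rw [Finset.sum_congr rfl fun s hs => (gridSum_indicator hn f (hpos s hs) δ).symm]
    unfold gridSum
    rw [Finset.sum_comm]
    refine Finset.sum_congr rfl fun i _ => ?_
    rw [← Finset.mul_sum, Finset.sum_sub_distrib, ← hsum, ← hsum]
  refine Tendsto.congr' h1 (tendsto_finsetSum _ fun s _ => ?_)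
  simp only [mem_univ, if_true]
  exact ((hf s).tendsto.comp (tendsto_gridPoint_ceil s)).mul_const δ

lemma gridSum_const {n : ℕ} (hn : 0 < n) (c : ℝ) (x : I → ℝ) :
    gridSum n (fun _ => c) x = c * (x 1 - x 0) := by
  unfold gridSum
  rw [← Finset.mul_sum, Finset.sum_range_sub (fun i => x (gridPoint n i)), gridPoint_self hn,
    gridPoint_zero]

lemma gridSum_sub_right (n : ℕ) (f x y : I → ℝ) :
    gridSum n f (fun t => x t - y t) = gridSum n f x - gridSum n f y := by
  unfold gridSum
  rw [← Finset.sum_sub_distrib]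
  exact Finset.sum_congr rfl fun i _ => by ring

lemma abs_gridSum_le (n : ℕ) {f x : I → ℝ} (hx : Monotone x) (h0 : x 0 = 0)
    (hf : ∀ t, |f t| ≤ 1) : |gridSum n f x| ≤ x 1 := by
  rcases Nat.eq_zero_or_pos n with rfl | hn
  · simpa [gridSum, h0] using hx (show (0 : I) ≤ 1 from le_top)
  have h1 : x 1 = gridSum n (fun _ => 1) x := by rw [gridSum_const hn, h0]; ring
  rw [h1]
  refine (Finset.abs_sum_le_sum_abs _ _).trans (Finset.sum_le_sum fun i _ => ?_)
  have h2 : 0 ≤ x (gridPoint n (i + 1)) - x (gridPoint n i) :=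
    sub_nonneg.2 (hx (gridPoint_mono n (Nat.le_succ i)))
  rw [abs_mul, abs_of_nonneg h2]
  exact mul_le_mul_of_nonneg_right (hf _) h2

/-! ### Tails of the difference of two Poisson variables -/

/-- The probability that `y + δ (N - M) ≥ z` for independent Poisson variables `N`, `M` with
parameter `r`. -/
noncomputable def skellamTail (δ z y : ℝ) (r : ℝ≥0) : ℝ :=
  ((poissonMeasure r).prod (poissonMeasure r)).real {q : ℕ × ℕ | z ≤ y + δ * ((q.1 : ℝ) - q.2)}

lemma poisson_prod_real_singleton (r : ℝ≥0) (q : ℕ × ℕ) :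
    ((poissonMeasure r).prod (poissonMeasure r)).real {q} =
      Real.exp (-2 * r) * ((r : ℝ) ^ (q.1 + q.2) / (q.1.factorial * q.2.factorial)) := by
  obtain ⟨a, b⟩ := q
  rw [← singleton_prod_singleton, measureReal_prod_prod, poissonMeasure_real_singleton,
    poissonMeasure_real_singleton, show (-2 * r : ℝ) = -r + -r by ring, Real.exp_add, pow_add]
  field_simp

lemma hasSum_sum_antidiagonal {f : ℕ × ℕ → ℝ} (hf : Summable f) :
    HasSum (fun n => ∑ q ∈ Finset.HasAntidiagonal.antidiagonal n, f q) (∑' q, f q) :=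
  HasSum.sigma (γ := fun n : ℕ => Finset.HasAntidiagonal.antidiagonal n)
    (f := fun q => f q.2)
    ((Finset.HasAntidiagonal.sigmaAntidiagonalEquivProd (A := ℕ)).hasSum_iff.2 hf.hasSum)
    (fun n => (Finset.HasAntidiagonal.antidiagonal n).hasSum f)

/-- Up to the factor `exp (-2 r)`, the probability of a set of pairs is a power series in `r` that
converges everywhere. -/
lemma exists_contDiff_poisson_prod (S : Set (ℕ × ℕ)) :
    ∃ F : ℝ → ℝ, ContDiff ℝ 1 F ∧
      ∀ r : ℝ≥0, ((poissonMeasure r).prod (poissonMeasure r)).real S = F r := by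
  classical
  let w : ℕ × ℕ → ℝ := fun q => if q ∈ S then ((q.1.factorial : ℝ) * q.2.factorial)⁻¹ else 0
  let c : ℕ → ℝ := fun n => ∑ q ∈ Finset.HasAntidiagonal.antidiagonal n, w q
  have hw0 : ∀ q, 0 ≤ w q := fun q => by
    simp only [w]; split_ifs <;> positivity
  have hsum : ∀ r : ℝ≥0, Summable fun q : ℕ × ℕ => w q * (r : ℝ) ^ (q.1 + q.2) := by
    intro r
    have h1 := (Real.summable_pow_div_factorial (r : ℝ)).mul_of_nonneg
      (Real.summable_pow_div_factorial (r : ℝ)) (fun n => by positivity) (fun n => by positivity)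
    refine h1.of_nonneg_of_le (fun q => mul_nonneg (hw0 q) (by positivity)) fun q => ?_
    have h2 : w q ≤ ((q.1.factorial : ℝ) * q.2.factorial)⁻¹ := by
      simp only [w]; split_ifs
      · exact le_rfl
      · positivity
    calc w q * (r : ℝ) ^ (q.1 + q.2)
        ≤ ((q.1.factorial : ℝ) * q.2.factorial)⁻¹ * (r : ℝ) ^ (q.1 + q.2) := by gcongr
      _ = _ := by rw [pow_add]; field_simp
  have hsum' : ∀ r : ℝ≥0, HasSum (fun n => c n * (r : ℝ) ^ n)
      (∑' q : ℕ × ℕ, w q * (r : ℝ) ^ (q.1 + q.2)) := by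
    intro r
    convert hasSum_sum_antidiagonal (hsum r) using 2 with n
    rw [Finset.sum_mul]
    refine Finset.sum_congr rfl fun q hq => ?_
    rw [← Finset.HasAntidiagonal.mem_antidiagonal.1 hq]
  have hrad : (FormalMultilinearSeries.ofScalars ℝ c).radius = ⊤ := by
    refine FormalMultilinearSeries.radius_eq_top_of_summable_norm _ fun r => ?_
    refine (hsum' r).summable.congr fun n => ?_
    rw [FormalMultilinearSeries.ofScalars_norm, Real.norm_of_nonneg]
    exact Finset.sum_nonneg fun q _ => hw0 q
  have hcd : ContDiff ℝ 1 (FormalMultilinearSeries.ofScalars ℝ c).sum := by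
    have h1 := (FormalMultilinearSeries.ofScalars ℝ c).hasFPowerSeriesOnBall (by simp [hrad])
    rw [hrad] at h1
    have h2 := h1.analyticOnNhd.contDiffOn (n := 1) (Metric.isOpen_eball.uniqueDiffOn)
    simpa [contDiffOn_univ] using h2
  refine ⟨fun x => Real.exp (-2 * x) * (FormalMultilinearSeries.ofScalars ℝ c).sum x,
    by fun_prop, fun r => ?_⟩
  have hF : (FormalMultilinearSeries.ofScalars ℝ c).sum (r : ℝ) =
      ∑' q : ℕ × ℕ, w q * (r : ℝ) ^ (q.1 + q.2) := by
    rw [← (hsum' r).tsum_eq]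
    refine tsum_congr fun n => ?_
    rw [FormalMultilinearSeries.ofScalars_apply_eq, smul_eq_mul]
  beta_reduce
  rw [hF, ← integral_indicator_one (MeasurableSet.of_discrete), integral_countable,
    ← tsum_mul_left]
  · refine tsum_congr fun q => ?_
    rw [poisson_prod_real_singleton]
    by_cases hq : q ∈ S <;> simp [w, hq]
    ring
  · exact (integrable_const (1 : ℝ)).indicator (MeasurableSet.of_discrete)

lemma exists_contDiff_skellamTail (δ z y : ℝ) :
    ∃ F : ℝ → ℝ, ContDiff ℝ 1 F ∧ ∀ r : ℝ≥0, skellamTail δ z y r = F r :=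
  exists_contDiff_poisson_prod _

/-- Since `N - M` charges every integer, the tail strictly increases along the lattice. -/
lemma skellamTail_lt {δ z y y' : ℝ} (hz : z ∈ lattice δ) (hy' : y' ∈ lattice δ)
    (h : y < y') {r : ℝ≥0} (hr : 0 < r) : skellamTail δ z y r < skellamTail δ z y' r := by
  obtain ⟨k, rfl⟩ := hz
  obtain ⟨l, rfl⟩ := hy'
  -- the pair for which `y' + δ (N - M)` is exactly `z`
  let q : ℕ × ℕ := ((k - l).toNat, (l - k).toNat)
  have hq : ((q.1 : ℝ) - q.2) = k - l := by
    have : ((q.1 : ℤ) - q.2) = k - l := by simp only [q]; omega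
    exact_mod_cast this
  have hpos : 0 < ((poissonMeasure r).prod (poissonMeasure r)).real {q} := by
    rw [poisson_prod_real_singleton]
    have : (0 : ℝ) < r := hr
    positivity
  have hdisj : Disjoint {q : ℕ × ℕ | δ * k ≤ y + δ * ((q.1 : ℝ) - q.2)} {q} := by
    rw [disjoint_singleton_right, mem_ofPred_eq, hq]
    intro hcon
    linarith
  have hsub : {q : ℕ × ℕ | δ * k ≤ y + δ * ((q.1 : ℝ) - q.2)} ∪ {q} ⊆
      {q : ℕ × ℕ | δ * k ≤ δ * l + δ * ((q.1 : ℝ) - q.2)} := by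
    rintro q' (h' | rfl)
    · simp only [mem_ofPred_eq] at h' ⊢
      linarith
    · simp only [mem_ofPred_eq]
      rw [hq]
      linarith
  have h1 := measureReal_mono (μ := (poissonMeasure r).prod (poissonMeasure r)) hsub
  rw [measureReal_union hdisj (MeasurableSet.of_discrete)] at h1
  unfold skellamTail
  linarith

lemma skellamTail_mem_Icc (δ z y : ℝ) (r : ℝ≥0) : skellamTail δ z y r ∈ Icc (0 : ℝ) 1 :=
  ⟨measureReal_nonneg, measureReal_le_one⟩

/-! ### Independence of σ-algebras -/

section Independence

variable {Ω : Type*} {m : MeasurableSpace Ω} {μ : Measure Ω}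

/-- If `b` is independent of `c`, and `a` of both together, then so is `a ⊔ b` of `c`. -/
lemma indep_sup_left [IsProbabilityMeasure μ] {a b c : MeasurableSpace Ω} (ha : a ≤ m)
    (hb : b ≤ m) (hc : c ≤ m) (h1 : Indep a (b ⊔ c) μ) (h2 : Indep b c μ) :
    Indep (a ⊔ b) c μ := by
  let π : Set (Set Ω) := {u | ∃ s t, MeasurableSet[a] s ∧ MeasurableSet[b] t ∧ s ∩ t = u}
  have hπ : a ⊔ b = MeasurableSpace.generateFrom π := by
    refine le_antisymm (sup_le (fun s hs => ?_) fun t ht => ?_)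
      (MeasurableSpace.generateFrom_le ?_)
    · exact MeasurableSpace.measurableSet_generateFrom ⟨s, univ, hs, MeasurableSet.univ, by simp⟩
    · exact MeasurableSpace.measurableSet_generateFrom ⟨univ, t, MeasurableSet.univ, ht, by simp⟩
    · rintro _ ⟨s, t, hs, ht, rfl⟩
      exact MeasurableSet.inter ((le_sup_left : a ≤ a ⊔ b) _ hs) ((le_sup_right : b ≤ a ⊔ b) _ ht)
  refine IndepSets.indep (p1 := π) (p2 := {s | MeasurableSet[c] s}) (sup_le ha hb) hc ?_
    (@MeasurableSpace.isPiSystem_measurableSet _ c) hπ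
    (@MeasurableSpace.generateFrom_measurableSet _ c).symm ?_
  · rintro _ ⟨s, t, hs, ht, rfl⟩ _ ⟨s', t', hs', ht', rfl⟩ -
    exact ⟨s ∩ s', t ∩ t', MeasurableSet.inter hs hs', MeasurableSet.inter ht ht', by
      rw [inter_inter_inter_comm]⟩
  · rw [IndepSets_iff]
    rintro _ u ⟨s, t, hs, ht, rfl⟩ hu
    rw [Indep_iff] at h1 h2
    have hbc : MeasurableSet[b ⊔ c] (t ∩ u) := MeasurableSet.inter
      ((le_sup_left : b ≤ b ⊔ c) _ ht) ((le_sup_right : c ≤ b ⊔ c) _ hu)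
    rw [inter_assoc, h1 s _ hs hbc, h2 t u ht hu,
      h1 s t hs ((le_sup_left : b ≤ b ⊔ c) _ ht), mul_assoc]

/-- Two independent families, each with independent past and future, have independent joint past
and joint future. -/
lemma indep_sup_sup [IsProbabilityMeasure μ] {a b c d : MeasurableSpace Ω} (ha : a ≤ m)
    (hb : b ≤ m) (hc : c ≤ m) (hd : d ≤ m) (h : Indep (a ⊔ b) (c ⊔ d) μ) (hab : Indep a b μ)
    (hcd : Indep c d μ) : Indep (a ⊔ c) (b ⊔ d) μ := by
  have h1 : Indep (b ⊔ d) c μ := indep_sup_left hb hd hc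
    (indep_of_indep_of_le h le_sup_right (sup_comm d c).le) hcd.symm
  have h2 : Indep ((c ⊔ d) ⊔ b) a μ := indep_sup_left (sup_le hc hd) hb ha
    (by rw [sup_comm b a]; exact h.symm) hab.symm
  refine indep_sup_left ha hc (sup_le hb hd) ?_ h1.symm
  refine indep_of_indep_of_le_right h2.symm ?_
  exact sup_le (le_sup_left.trans le_sup_left) (sup_le le_sup_right (le_sup_right.trans le_sup_left))

lemma indep_eventually_left {a b : MeasurableSpace Ω} (h : Indep a b μ) :
    Indep (eventuallyMeasurableSpace a (ae μ)) b μ := by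
  rw [Indep_iff] at h ⊢
  rintro s u ⟨t, ht, hst⟩ hu
  rw [measure_congr hst, ← h t u ht hu]
  exact measure_congr (hst.inter (ae_eq_refl u))

lemma indep_eventually {a b : MeasurableSpace Ω} (h : Indep a b μ) :
    Indep (eventuallyMeasurableSpace a (ae μ)) (eventuallyMeasurableSpace b (ae μ)) μ :=
  indep_eventually_left (indep_eventually_left h.symm).symm

end Independence

lemma measurable_terminalPrice (z : ℝ) : Measurable (terminalPrice z) :=
  Measurable.ite measurableSet_Ici measurable_const measurable_const

/-- A function that is independent of the first variable may be integrated out. -/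
lemma integral_mul_real_of_indep {Ω : Type*} {F m : MeasurableSpace Ω} {μ : Measure Ω}
    [IsProbabilityMeasure μ] (hF : F ≤ m)
    {D W U : Ω → ℝ} (hD : Measurable D) (hind : Indep F (MeasurableSpace.comap D inferInstance) μ)
    (hW : Measurable[F] W) (hU : Measurable[F] U) (hWi : Integrable W μ) (z : ℝ) :
    ∫ ω, W ω * μ.real {ω' | z ≤ U ω + D ω'} ∂μ = ∫ ω, W ω * terminalPrice z (U ω + D ω) ∂μ := by
  have hWU : Measurable[F] (fun ω => (W ω, U ω)) := hW.prodMk hU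
  have hWU' : Measurable (fun ω => (W ω, U ω)) := hWU.mono hF le_rfl
  have hi : IndepFun (fun ω => (W ω, U ω)) D μ := by
    rw [IndepFun_iff_Indep]
    exact indep_of_indep_of_le_left hind hWU.comap_le
  rw [indepFun_iff_map_prod_eq_prod_map_map hWU'.aemeasurable hD.aemeasurable] at hi
  have := Measure.isProbabilityMeasure_map (μ := μ) hD.aemeasurable
  have := Measure.isProbabilityMeasure_map (μ := μ) hWU'.aemeasurable
  let f : (ℝ × ℝ) × ℝ → ℝ := fun q => q.1.1 * terminalPrice z (q.1.2 + q.2)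
  have htp := measurable_terminalPrice z
  have hf : Measurable f := by fun_prop
  have hpair : Measurable (fun ω => ((W ω, U ω), D ω)) := hWU'.prodMk hD
  have h1 : ∫ ω, W ω * terminalPrice z (U ω + D ω) ∂μ =
      ∫ q, f q ∂(μ.map (fun ω => ((W ω, U ω), D ω))) :=
    (integral_map hpair.aemeasurable hf.aestronglyMeasurable).symm
  have hb : ∀ x, ‖terminalPrice z x‖ ≤ 1 := fun x => by
    unfold terminalPrice; split_ifs <;> simp
  have hfi : Integrable f (μ.map (fun ω => ((W ω, U ω), D ω))) := by
    rw [integrable_map_measure hf.aestronglyMeasurable hpair.aemeasurable]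
    refine hWi.mul_of_top_left ?_
    exact memLp_top_of_bound
      ((htp.comp ((measurable_snd.comp measurable_fst).add measurable_snd)).comp
        hpair).aestronglyMeasurable 1 (ae_of_all _ fun ω => hb _)
  rw [hi] at h1 hfi
  rw [h1, integral_prod _ hfi, integral_map hWU'.aemeasurable]
  · refine integral_congr_ae (ae_of_all _ fun ω => ?_)
    simp only [f]
    have htp' : Measurable fun x => terminalPrice z (U ω + x) :=
      htp.comp (measurable_const_add (U ω))
    rw [integral_const_mul, integral_map hD.aemeasurable htp'.aestronglyMeasurable]
    congr 1
    have hs : MeasurableSet {ω' | z ≤ U ω + D ω'} :=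
      measurableSet_le measurable_const (hD.const_add _)
    rw [← integral_indicator_one hs]
    refine integral_congr_ae (ae_of_all _ fun ω' => ?_)
    simp [terminalPrice, indicator]
  · exact hf.stronglyMeasurable.integral_prod_right.aestronglyMeasurable

lemma measurable_indicator_one {Ω : Type*} {F : MeasurableSpace Ω} {s : Set Ω}
    (hs : MeasurableSet s) : Measurable (s.indicator (1 : Ω → ℝ)) :=
  measurable_one.indicator hs

lemma setIntegral_real_of_indep {Ω : Type*} {F m : MeasurableSpace Ω} {μ : Measure Ω}
    [IsProbabilityMeasure μ] (hF : F ≤ m) {D U : Ω → ℝ} (hD : Measurable D)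
    (hind : Indep F (MeasurableSpace.comap D inferInstance) μ) (hU : Measurable[F] U)
    {s : Set Ω} (hs : MeasurableSet[F] s) (z : ℝ) :
    ∫ ω in s, μ.real {ω' | z ≤ U ω + D ω'} ∂μ = ∫ ω in s, terminalPrice z (U ω + D ω) ∂μ := by
  have h1 := integral_mul_real_of_indep hF hD hind (measurable_indicator_one hs) hU
    ((integrable_const (1 : ℝ)).indicator (hF s hs)) z
  have h2 : ∀ f : Ω → ℝ, ∫ ω, s.indicator 1 ω * f ω ∂μ = ∫ ω in s, f ω ∂μ := by
    intro f
    rw [← integral_indicator (hF s hs)]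
    exact integral_congr_ae (ae_of_all _ fun ω => by simp [indicator])
  rwa [h2, h2] at h1

lemma measurable_const_mul_sub {Ω : Type*} {a : MeasurableSpace Ω} {f g : Ω → ℝ}
    (hf : Measurable f) (hg : Measurable g) (δ : ℝ) : Measurable fun ω => δ * (f ω - g ω) :=
  (hf.sub hg).const_mul δ

/-! ### Differences of two independent Poisson processes -/

section PoissonDifference

variable {Ω : Type*} {m : MeasurableSpace Ω} {μ : Measure Ω}

/-- The σ-algebra generated by the increments of `N` from time `0` up to times `s ≤ t`. -/
@[reducible] def pastIncrements (N : I → Ω → ℝ) (t : I) : MeasurableSpace Ω :=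
  ⨆ s : Iic t, MeasurableSpace.comap (fun ω => N s ω - N 0 ω) inferInstance

lemma pastIncrements_le {N : I → Ω → ℝ} (hN : ∀ t, Measurable (N t)) (t : I) :
    pastIncrements N t ≤ m :=
  iSup_le fun s => ((hN s).sub (hN 0)).comap_le

lemma indep_pastIncrements [IsProbabilityMeasure μ] {N : I → Ω → ℝ}
    (hN : ∀ t, Measurable (N t)) (hinc : HasIndepIncrements N μ) (t : I) :
    Indep (pastIncrements N t)
      (MeasurableSpace.comap (fun ω => N 1 ω - N t ω) inferInstance) μ := by
  classical
  unfold pastIncrements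
  rw [iSup_eq_iSup_finset]
  refine indep_iSup_of_directed_le (fun F => ?_)
    (fun F => iSup₂_le fun s _ => ((hN s).sub (hN 0)).comap_le) ((hN 1).sub (hN t)).comap_le ?_
  · -- enumerate `0`, `t` and the times in `F`, and continue with `1`
    let S : Finset I := insert 0 (insert t (F.map (Function.Embedding.subtype _)))
    have hS0 : (0 : I) ∈ S := Finset.mem_insert_self _ _
    have hSt : t ∈ S := by simp [S]
    have hle : ∀ s ∈ S, s ≤ t := by
      intro s hs
      simp only [S, Finset.mem_insert, Finset.mem_map, Function.Embedding.subtype_apply,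
        Subtype.exists] at hs
      rcases hs with rfl | rfl | ⟨s, hs, hst, -, rfl⟩
      · exact t.2.1
      · exact le_rfl
      · exact hst
    have hc : 0 < S.card := Finset.card_pos.2 ⟨0, hS0⟩
    let e := S.orderEmbOfFin rfl
    let T : ℕ → I := fun i => if h : i < S.card then e ⟨i, h⟩ else 1
    have hT : Monotone T := by
      intro i j hij
      simp only [T]
      split_ifs with h1 h2 h2
      · exact e.monotone (by simpa using hij)
      · exact le_top
      · omega
      · exact le_rfl
    have hT0 : T 0 = 0 := by
      simp only [T, dif_pos hc, e]
      rw [Finset.orderEmbOfFin_zero rfl hc]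
      exact le_antisymm (Finset.min'_le _ _ hS0) bot_le
    have hTlast : T (S.card - 1) = t := by
      simp only [T, dif_pos (show S.card - 1 < S.card by omega), e]
      rw [Finset.orderEmbOfFin_last rfl hc]
      exact le_antisymm (Finset.max'_le _ _ _ hle) (Finset.le_max' _ _ hSt)
    have hTend : T (S.card - 1 + 1) = 1 := by
      simp only [T]
      rw [dif_neg (by omega)]
    have hind := (hinc.nat hT).indepFun_finset (Finset.range (S.card - 1)) {S.card - 1} (by simp)
      (fun i => (hN _).sub (hN _))
    rw [IndepFun_iff_Indep] at hind
    refine indep_of_indep_of_le hind (iSup₂_le fun s hs => ?_) ?_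
    · have hsS : (s : I) ∈ S := by
        simp only [S, Finset.mem_insert, Finset.mem_map]
        exact Or.inr (Or.inr ⟨s, hs, rfl⟩)
      have : (s : I) ∈ Set.range e := by rw [Finset.range_orderEmbOfFin]; exact hsS
      obtain ⟨⟨j, hj⟩, hjs⟩ := this
      have hTj : T j = s := by simp only [T, dif_pos hj, hjs]
      have hsum : (fun ω => N s ω - N 0 ω) =
          (fun x : Finset.range (S.card - 1) → ℝ =>
            ∑ i ∈ (Finset.range j).attach, x ⟨i, by
              have := Finset.mem_range.1 i.2; simp; omega⟩) ∘
          (fun ω (i : Finset.range (S.card - 1)) => N (T (i + 1)) ω - N (T i) ω) := by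
        ext ω
        simp only [Function.comp]
        rw [Finset.sum_attach (Finset.range j) (fun i => N (T (i + 1)) ω - N (T i) ω),
          Finset.sum_range_sub (fun i => N (T i) ω), hTj, hT0]
      rw [hsum, ← MeasurableSpace.comap_comp]
      exact MeasurableSpace.comap_mono (Measurable.comap_le (by fun_prop))
    · have hsum : (fun ω => N 1 ω - N t ω) =
          (fun x : ({S.card - 1} : Finset ℕ) → ℝ => x ⟨S.card - 1, by simp⟩) ∘
          (fun ω (i : ({S.card - 1} : Finset ℕ)) => N (T (i + 1)) ω - N (T i) ω) := by
        ext ω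
        simp only [Function.comp, hTlast, hTend]
      rw [hsum, ← MeasurableSpace.comap_comp]
      exact MeasurableSpace.comap_mono (Measurable.comap_le (by fun_prop))
  · exact directed_of_isDirected_le fun F G (hFG : F ⊆ G) => biSup_mono fun s hs => hFG hs

/-- `Y = δ (N - M)` almost surely, for two independent Poisson processes `N` and `M` of
intensity `β`. -/
structure IsPoissonDifference (μ : Measure Ω) (δ : ℝ) (β : ℝ≥0) (N M Y : I → Ω → ℝ) : Prop where
  delta_pos : 0 < δ
  measurable : ∀ t, Measurable (Y t)
  left : IsPoissonProcess μ β N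
  right : IsPoissonProcess μ β M
  indep : IndepProcesses μ N M
  eq : ∀ᵐ ω ∂μ, ∀ t, Y t ω = δ * (N t ω - M t ω)

lemma IsPoissonDifference.of_div {δ : ℝ} (hδ : 0 < δ) {β : ℝ≥0} {A B Y : I → Ω → ℝ}
    (hY : ∀ t, Measurable (Y t)) (hA : IsPoissonProcess μ β (fun t ω => A t ω / δ))
    (hB : IsPoissonProcess μ β (fun t ω => B t ω / δ)) (hAB : IndepProcesses μ A B)
    (h : ∀ᵐ ω ∂μ, ∀ t, Y t ω = A t ω - B t ω) :
    IsPoissonDifference μ δ β (fun t ω => A t ω / δ) (fun t ω => B t ω / δ) Y where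
  delta_pos := hδ
  measurable := hY
  left := hA
  right := hB
  indep := by
    have hm : Measurable (fun (x : I → ℝ) t => x t / δ) := by fun_prop
    exact IndepFun.comp hAB hm hm
  eq := by
    filter_upwards [h] with ω hω t
    rw [hω t]
    field_simp

variable {δ : ℝ} {β : ℝ≥0} {N M Y : I → Ω → ℝ}

lemma comap_le_comap_path (N : I → Ω → ℝ) {f : (I → ℝ) → ℝ} (hf : Measurable f) :
    MeasurableSpace.comap (fun ω => f (fun t => N t ω)) inferInstance ≤
      MeasurableSpace.comap (fun ω t => N t ω) inferInstance := by
  rw [show (fun ω => f (fun t => N t ω)) = f ∘ (fun ω t => N t ω) from rfl,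
    ← MeasurableSpace.comap_comp]
  exact MeasurableSpace.comap_mono hf.comap_le

lemma pastIncrements_le_comap_path (N : I → Ω → ℝ) (t : I) :
    pastIncrements N t ≤ MeasurableSpace.comap (fun ω t => N t ω) inferInstance :=
  iSup_le fun s => comap_le_comap_path N (f := fun x => x s - x 0) (by fun_prop)

lemma comap_le_eventually_of_ae_eq {a : MeasurableSpace Ω} {f g : Ω → ℝ} (hg : Measurable[a] g)
    (h : f =ᵐ[μ] g) :
    MeasurableSpace.comap f inferInstance ≤ eventuallyMeasurableSpace a (ae μ) := by
  rintro _ ⟨B, hB, rfl⟩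
  exact ⟨g ⁻¹' B, hg hB, h.preimage B⟩

/-- Before completion, the past and the future increment of `N - M` are independent. -/
lemma IsPoissonDifference.indep_past [IsProbabilityMeasure μ]
    (h : IsPoissonDifference μ δ β N M Y) (t : I) :
    Indep (pastIncrements N t ⊔ pastIncrements M t)
      (MeasurableSpace.comap (fun ω => N 1 ω - N t ω) inferInstance ⊔
        MeasurableSpace.comap (fun ω => M 1 ω - M t ω) inferInstance) μ := by
  have hN := h.left.measurable
  have hM := h.right.measurable
  refine indep_sup_sup (pastIncrements_le hN t) ((hN 1).sub (hN t)).comap_le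
    (pastIncrements_le hM t) ((hM 1).sub (hM t)).comap_le ?_
    (indep_pastIncrements hN h.left.indep t) (indep_pastIncrements hM h.right.indep t)
  have hi := h.indep
  unfold IndepProcesses at hi
  rw [IndepFun_iff_Indep] at hi
  refine indep_of_indep_of_le hi (sup_le (pastIncrements_le_comap_path N t) ?_)
    (sup_le (pastIncrements_le_comap_path M t) ?_)
  · exact comap_le_comap_path N (f := fun x => x 1 - x t) (by fun_prop)
  · exact comap_le_comap_path M (f := fun x => x 1 - x t) (by fun_prop)

/-- Up to null sets, the past of `Y` is generated by the increments of `N` and `M`. -/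
lemma IsPoissonDifference.completedNatural_le (h : IsPoissonDifference μ δ β N M Y) (t : I) :
    completedNatural μ Y t ≤
      eventuallyMeasurableSpace (pastIncrements N t ⊔ pastIncrements M t) (ae μ) := by
  refine MeasurableSpace.generateFrom_le ?_
  rintro s ⟨-, hs | ⟨u, hu, B, hB, rfl⟩⟩
  · exact ⟨∅, MeasurableSpace.measurableSet_empty _, ae_eq_empty.2 hs⟩
  · refine comap_le_eventually_of_ae_eq
      (g := fun ω => δ * ((N u ω - N 0 ω) - (M u ω - M 0 ω))) ?_ ?_ _ ⟨B, hB, rfl⟩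
    · have h1 : Measurable[pastIncrements N t ⊔ pastIncrements M t]
          (fun ω => N u ω - N 0 ω) :=
        (comap_measurable _).mono (le_sup_of_le_left (le_iSup (fun s : Iic t =>
          MeasurableSpace.comap (fun ω => N s ω - N 0 ω) inferInstance) ⟨u, hu⟩)) le_rfl
      have h2 : Measurable[pastIncrements N t ⊔ pastIncrements M t]
          (fun ω => M u ω - M 0 ω) :=
        (comap_measurable _).mono (le_sup_of_le_right (le_iSup (fun s : Iic t =>
          MeasurableSpace.comap (fun ω => M s ω - M 0 ω) inferInstance) ⟨u, hu⟩)) le_rfl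
      exact (h1.sub h2).const_mul δ
    · filter_upwards [h.eq, h.left.path, h.right.path] with ω h1 h2 h3
      have h4 : N 0 ω = 0 := h2.zero
      have h5 : M 0 ω = 0 := h3.zero
      rw [h1 u, h4, h5, sub_zero, sub_zero]

lemma IsPoissonDifference.indep_completedNatural [IsProbabilityMeasure μ]
    (h : IsPoissonDifference μ δ β N M Y) (t : I) :
    Indep (completedNatural μ Y t)
      (MeasurableSpace.comap (fun ω => Y 1 ω - Y t ω) inferInstance) μ := by
  refine indep_of_indep_of_le (indep_eventually (h.indep_past t)) (h.completedNatural_le t) ?_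
  refine comap_le_eventually_of_ae_eq
    (g := fun ω => δ * ((N 1 ω - N t ω) - (M 1 ω - M t ω))) ?_ ?_
  · refine measurable_const_mul_sub (Measurable.mono (comap_measurable _) ?_ le_rfl)
      (Measurable.mono (comap_measurable _) ?_ le_rfl) δ
    · exact le_sup_left
    · exact le_sup_right
  · filter_upwards [h.eq] with ω h1
    rw [h1, h1]
    ring

/-- Almost every path of `Y` stays in the lattice and is constant just after any time. -/
lemma IsPoissonDifference.path (h : IsPoissonDifference μ δ β N M Y) :
    ∀ᵐ ω ∂μ, ∀ t, Y t ω ∈ lattice δ ∧ ∀ᶠ s in 𝓝[≥] t, Y s ω = Y t ω := by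
  filter_upwards [h.eq, h.left.path, h.right.path] with ω h1 h2 h3 t
  constructor
  · obtain ⟨a, ha⟩ := h2.values t
    obtain ⟨b, hb⟩ := h3.values t
    refine ⟨a - b, ?_⟩
    rw [h1, ha, hb]
    push_cast
    ring
  · filter_upwards [h2.eventually_eq one_pos t, h3.eventually_eq one_pos t] with s h4 h5
    rw [h1, h1, h4, h5]

/-- The increments of `Y` after time `t` are independent of the right-continuous augmentation of
its past: compare with slightly later times, at which `Y` has not moved yet. -/
lemma IsPoissonDifference.indep_generatedFiltration [IsProbabilityMeasure μ]
    (h : IsPoissonDifference μ δ β N M Y) (t : I) :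
    Indep (generatedFiltration μ Y t)
      (MeasurableSpace.comap (fun ω => Y 1 ω - Y t ω) inferInstance) μ := by
  unfold generatedFiltration
  rcases eq_or_lt_of_le (show t ≤ 1 from le_top) with rfl | ht
  · rw [Filtration.rightCont_eq_of_isMax (i := (1 : I)) _ isMax_top]
    exact h.indep_completedNatural 1
  have hne : (𝓝[>] t).NeBot := nhdsGT_neBot_of_exists_gt ⟨1, ht⟩
  rw [Filtration.rightCont_eq_of_neBot_nhdsGT]
  rw [Indep_iff]
  rintro A _ hA ⟨B, hB, rfl⟩
  have hAm : MeasurableSet A := by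
    have h1 : MeasurableSet[completedNatural μ Y 1] A :=
      (iInf₂_le (1 : I) ht : (⨅ j, ⨅ (_ : j > t), completedNatural μ Y j) ≤ _) _ hA
    exact (completedNatural μ Y).le 1 _ h1
  have hC : ∀ s, MeasurableSet ((fun ω => Y 1 ω - Y s ω) ⁻¹' B) := fun s =>
    ((h.measurable 1).sub (h.measurable s)) hB
  have hev : ∀ᵐ ω ∂μ, ∀ᶠ s in 𝓝[>] t, Y s ω = Y t ω := by
    filter_upwards [h.path] with ω hω
    exact (hω t).2.filter_mono (nhdsWithin_mono _ Ioi_subset_Ici_self)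
  have h1 : Tendsto (fun s => μ ((fun ω => Y 1 ω - Y s ω) ⁻¹' B)) (𝓝[>] t)
      (𝓝 (μ ((fun ω => Y 1 ω - Y t ω) ⁻¹' B))) := by
    refine tendsto_measure_of_ae_tendsto_indicator_of_isFiniteMeasure _ (hC t) hC ?_
    filter_upwards [hev] with ω hω
    filter_upwards [hω] with s hs
    simp [hs]
  have h2 : Tendsto (fun s => μ (A ∩ (fun ω => Y 1 ω - Y s ω) ⁻¹' B)) (𝓝[>] t)
      (𝓝 (μ (A ∩ (fun ω => Y 1 ω - Y t ω) ⁻¹' B))) := by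
    refine tendsto_measure_of_ae_tendsto_indicator_of_isFiniteMeasure _ (hAm.inter (hC t))
      (fun s => hAm.inter (hC s)) ?_
    filter_upwards [hev] with ω hω
    filter_upwards [hω] with s hs
    simp [hs]
  refine tendsto_nhds_unique h2 ?_
  refine (ENNReal.Tendsto.const_mul h1 (Or.inr (measure_ne_top _ _))).congr' ?_
  filter_upwards [self_mem_nhdsWithin] with s hs
  have h3 := h.indep_completedNatural s
  rw [Indep_iff] at h3
  exact (h3 A _ ((iInf₂_le s hs : (⨅ j, ⨅ (_ : j > t), completedNatural μ Y j) ≤ _) _ hA)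
    ⟨B, hB, rfl⟩).symm

lemma measurable_generatedFiltration (hY : ∀ t, Measurable (Y t)) (t : I) :
    Measurable[generatedFiltration μ Y t] (Y t) := by
  intro B hB
  refine Filtration.le_rightCont (completedNatural μ Y) t _ ?_
  exact MeasurableSpace.measurableSet_generateFrom ⟨hY t hB, Or.inr ⟨t, le_rfl, B, hB, rfl⟩⟩

/-- The transition probabilities of `Y`. -/
lemma IsPoissonDifference.real_tail [IsProbabilityMeasure μ]
    (h : IsPoissonDifference μ δ β N M Y) (z y : ℝ) (t : I) :
    μ.real {ω | z ≤ y + (Y 1 ω - Y t ω)} =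
      skellamTail δ z y (β * Real.toNNReal ((1 : I) - t : ℝ)) := by
  set r := β * Real.toNNReal ((1 : I) - t : ℝ)
  have hN := h.left.measurable
  have hM := h.right.measurable
  have hind : IndepFun (fun ω => N 1 ω - N t ω) (fun ω => M 1 ω - M t ω) μ :=
    IndepFun.comp h.indep (φ := fun x : I → ℝ => x 1 - x t) (ψ := fun x : I → ℝ => x 1 - x t)
      (by fun_prop) (by fun_prop)
  have hNm : Measurable (fun ω => N 1 ω - N t ω) := (hN 1).sub (hN t)
  have hMm : Measurable (fun ω => M 1 ω - M t ω) := (hM 1).sub (hM t)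
  rw [indepFun_iff_map_prod_eq_prod_map_map hNm.aemeasurable hMm.aemeasurable,
    h.left.law t 1 le_top, h.right.law t 1 le_top,
    Measure.map_prod_map _ _ measurable_from_top measurable_from_top] at hind
  have hS : MeasurableSet {q : ℝ × ℝ | z ≤ y + δ * (q.1 - q.2)} :=
    measurableSet_le measurable_const (by fun_prop)
  have h1 : μ.real {ω | z ≤ y + (Y 1 ω - Y t ω)} =
      (μ.map fun ω => (N 1 ω - N t ω, M 1 ω - M t ω)).real
        {q : ℝ × ℝ | z ≤ y + δ * (q.1 - q.2)} := by
    rw [map_measureReal_apply (hNm.prodMk hMm) hS]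
    refine measureReal_congr ?_
    filter_upwards [h.eq] with ω hω
    apply propext
    change z ≤ y + (Y 1 ω - Y t ω) ↔ z ≤ y + δ * (N 1 ω - N t ω - (M 1 ω - M t ω))
    rw [hω, hω]
    ring_nf
  rw [h1, hind, map_measureReal_apply (by fun_prop) hS]
  rfl

/-! ### Simultaneous jumps of independent Poisson processes -/

lemma IsPoissonProcess.measure_sub_ne_zero_le {β : ℝ≥0} (hN : IsPoissonProcess μ β N)
    {s t : I} (hst : s ≤ t) :
    μ {ω | N t ω - N s ω ≠ 0} ≤ ENNReal.ofReal (β * (t - s)) := by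
  have hm : Measurable (fun ω => N t ω - N s ω) := (hN.measurable t).sub (hN.measurable s)
  have hB : MeasurableSet ({0}ᶜ : Set ℝ) := (measurableSet_singleton 0).compl
  have h0 : (Nat.cast : ℕ → ℝ) ⁻¹' {0}ᶜ = {0}ᶜ := by ext n; simp
  have h1 : μ {ω | N t ω - N s ω ≠ 0} = μ.map (fun ω => N t ω - N s ω) {0}ᶜ :=
    (Measure.map_apply hm hB).symm
  rw [h1, hN.law s t hst, Measure.map_apply measurable_from_top hB, h0,
    prob_compl_eq_one_sub (measurableSet_singleton 0), poissonMeasure_singleton]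
  rw [← ENNReal.ofReal_one, ← ENNReal.ofReal_sub _ (by positivity)]
  refine ENNReal.ofReal_le_ofReal ?_
  have h2 : (0 : ℝ) ≤ t - s := sub_nonneg.2 hst
  have h3 := Real.add_one_le_exp (-(β * (t - s) : ℝ))
  simp [Real.coe_toNNReal _ h2]
  simp at h3
  linarith

/-- A jump at `t` shows up as a nonzero increment over the grid interval that contains `t`. -/
lemma exists_gridPoint_sub_ne_zero {x : I → ℝ} (hx : Monotone x) {t : I} (ht : jump x t ≠ 0)
    {n i : ℕ} (h1 : gridPoint n i < t) (h2 : t ≤ gridPoint n (i + 1)) :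
    x (gridPoint n (i + 1)) - x (gridPoint n i) ≠ 0 := by
  have h3 := hx.le_leftLim h1
  have h4 := hx h2
  have h5 : Function.leftLim x t < x t :=
    lt_of_le_of_ne (hx.leftLim_le le_rfl) fun h => ht (by rw [jump, h, sub_self])
  linarith

lemma ae_no_common_jump [IsProbabilityMeasure μ] {β : ℝ≥0} (hN : IsPoissonProcess μ β N)
    (hM : IsPoissonProcess μ β M) (hNM : IndepProcesses μ N M) :
    ∀ᵐ ω ∂μ, ∀ t, jump (fun s => N s ω) t = 0 ∨ jump (fun s => M s ω) t = 0 := by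
  let E : ℕ → ℕ → Set Ω := fun n i =>
    {ω | N (gridPoint n (i + 1)) ω - N (gridPoint n i) ω ≠ 0} ∩
      {ω | M (gridPoint n (i + 1)) ω - M (gridPoint n i) ω ≠ 0}
  let G : Set Ω := {ω | IsPointPath 1 (fun t => N t ω) ∧ IsPointPath 1 (fun t => M t ω)}
  let C : Set Ω := {ω | ∃ t, jump (fun s => N s ω) t ≠ 0 ∧ jump (fun s => M s ω) t ≠ 0} ∩ G
  have hC : ∀ n : ℕ, 0 < n → C ⊆ ⋃ i ∈ Finset.range n, E n i := by
    rintro n hn ω ⟨⟨t, h1, h2⟩, h3, h4⟩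
    have ht : 0 < t := by
      refine lt_of_le_of_ne t.2.1 fun h => h1 ?_
      rw [← show 0 = t from h, jump_zero]
    have hpos : 0 < ⌈(t : ℝ) * n⌉₊ := by
      have : (0 : ℝ) < t := ht
      exact Nat.ceil_pos.2 (by positivity)
    obtain ⟨k, hk⟩ := Nat.exists_eq_add_of_le' hpos
    have hkn : k < n := by have := ceil_mul_le n t; omega
    have h5 : gridPoint n k < t := by
      rw [← not_le, le_gridPoint_iff hn hkn.le]; omega
    have h6 : t ≤ gridPoint n (k + 1) := by
      rw [le_gridPoint_iff hn (by omega)]; omega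
    simp only [mem_iUnion]
    exact ⟨k, Finset.mem_range.2 hkn, exists_gridPoint_sub_ne_zero h3.mono h1 h5 h6,
      exists_gridPoint_sub_ne_zero h4.mono h2 h5 h6⟩
  -- the grid of mesh `1 / n` has `n` cells, each contributing at most `(β / n) ^ 2`
  have hE : ∀ n : ℕ, 0 < n → ∀ i ∈ Finset.range n, μ (E n i) ≤ ENNReal.ofReal ((β / n) ^ 2) := by
    intro n hn i hi
    have hi := Finset.mem_range.1 hi
    have hmono : gridPoint n i ≤ gridPoint n (i + 1) := gridPoint_mono n (Nat.le_succ i)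
    have hlen : (β : ℝ) * ((gridPoint n (i + 1) : ℝ) - gridPoint n i) = β / n := by
      rw [coe_gridPoint (by omega), coe_gridPoint hi.le]
      push_cast
      field_simp
      ring
    have hind : IndepFun (fun ω => N (gridPoint n (i + 1)) ω - N (gridPoint n i) ω)
        (fun ω => M (gridPoint n (i + 1)) ω - M (gridPoint n i) ω) μ :=
      IndepFun.comp hNM (φ := fun x : I → ℝ => x (gridPoint n (i + 1)) - x (gridPoint n i))
        (ψ := fun x : I → ℝ => x (gridPoint n (i + 1)) - x (gridPoint n i))
        (by fun_prop) (by fun_prop)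
    have hB : MeasurableSet ({0}ᶜ : Set ℝ) := (measurableSet_singleton 0).compl
    have h1 : μ (E n i) = μ {ω | N (gridPoint n (i + 1)) ω - N (gridPoint n i) ω ≠ 0} *
        μ {ω | M (gridPoint n (i + 1)) ω - M (gridPoint n i) ω ≠ 0} :=
      hind.measure_inter_preimage_eq_mul _ _ hB hB
    have h2 := hN.measure_sub_ne_zero_le hmono
    have h3 := hM.measure_sub_ne_zero_le hmono
    rw [hlen] at h2 h3
    rw [h1, pow_two, ENNReal.ofReal_mul (by positivity)]
    exact mul_le_mul' h2 h3
  have hC0 : μ C = 0 := by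
    have h1 : ∀ᶠ n : ℕ in atTop, μ C ≤ ENNReal.ofReal ((β : ℝ) ^ 2 * (1 / n)) := by
      filter_upwards [eventually_gt_atTop 0] with n hn
      calc μ C ≤ μ (⋃ i ∈ Finset.range n, E n i) := measure_mono (hC n hn)
        _ ≤ ∑ i ∈ Finset.range n, μ (E n i) := measure_biUnion_finset_le _ _
        _ ≤ ∑ i ∈ Finset.range n, ENNReal.ofReal ((β / n) ^ 2) := Finset.sum_le_sum (hE n hn)
        _ = ENNReal.ofReal ((β : ℝ) ^ 2 * (1 / n)) := by
          rw [Finset.sum_const, Finset.card_range, nsmul_eq_mul, ← ENNReal.ofReal_natCast,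
            ← ENNReal.ofReal_mul (by positivity)]
          congr 1
          field_simp
    have h2 : Tendsto (fun n : ℕ => ENNReal.ofReal ((β : ℝ) ^ 2 * (1 / n))) atTop (𝓝 0) := by
      have := (tendsto_one_div_atTop_nhds_zero_nat (𝕜 := ℝ)).const_mul ((β : ℝ) ^ 2)
      simpa using ENNReal.tendsto_ofReal this
    exact le_antisymm (ge_of_tendsto h2 h1) bot_le
  have hCae : ∀ᵐ ω ∂μ, ω ∉ C := measure_eq_zero_iff_ae_notMem.1 hC0
  filter_upwards [hCae, hN.path, hM.path] with ω h1 h2 h3 t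
  by_contra! hcon
  exact h1 ⟨⟨t, hcon⟩, h2, h3⟩

end PoissonDifference

section Pricing

variable {Ω : Type*} {m : MeasurableSpace Ω} {μ : Measure Ω}

/-! ### The pricing rule -/

/-- The probability that `y + δ (N - M)` ends up above `z`, when `N` and `M` are independent Poisson
processes of intensity `β` running from time `t` to time `1`. -/
noncomputable def poissonPrice (δ : ℝ) (β : ℝ≥0) (z y : ℝ) (t : I) : ℝ :=
  skellamTail δ z y (β * Real.toNNReal ((1 : I) - t : ℝ))

variable {δ : ℝ} {β : ℝ≥0} {N M Y : I → Ω → ℝ}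

lemma poissonPrice_mem_Icc (z y : ℝ) (t : I) : poissonPrice δ β z y t ∈ Icc (0 : ℝ) 1 :=
  skellamTail_mem_Icc _ _ _ _

lemma measurable_poissonPrice (z : ℝ) (t : I) :
    Measurable fun y => poissonPrice δ β z y t := by
  refine Monotone.measurable fun y y' h => measureReal_mono fun q hq => ?_
  simp only [mem_ofPred_eq] at hq ⊢
  linarith

lemma integral_terminalPrice [IsProbabilityMeasure μ] {D : Ω → ℝ} (hD : Measurable D) (z : ℝ) :
    ∫ ω, terminalPrice z (D ω) ∂μ = μ.real {ω | z ≤ D ω} := by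
  rw [← integral_indicator_one (measurableSet_le measurable_const hD)]
  exact integral_congr_ae (ae_of_all _ fun ω => by simp [terminalPrice, indicator])

/-- The function `p^z` of a difference of Poisson processes is given by their transition
probabilities. -/
lemma IsPoissonDifference.markovPrice_eq [IsProbabilityMeasure μ]
    (h : IsPoissonDifference μ δ β N M Y) (z y : ℝ) (t : I) :
    markovPrice μ Y z y t = poissonPrice δ β z y t := by
  have hD : Measurable fun ω => Y 1 ω - Y t ω := (h.measurable 1).sub (h.measurable t)
  unfold markovPrice poissonPrice
  split_ifs with h0
  · rw [integral_terminalPrice (hD.const_add y), h.real_tail]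
  · have hS : MeasurableSet[generatedFiltration μ Y t] {ω | Y t ω = y} :=
      measurable_generatedFiltration h.measurable t (measurableSet_singleton y)
    have hS' : MeasurableSet {ω | Y t ω = y} := (generatedFiltration μ Y).le t _ hS
    have h1 := setIntegral_real_of_indep ((generatedFiltration μ Y).le t) hD
      (h.indep_generatedFiltration t) (measurable_generatedFiltration h.measurable t) hS z
    simp only [h.real_tail, add_sub_cancel] at h1
    rw [setIntegral_congr_fun hS' (g := fun _ => skellamTail δ z y _)
      (fun ω hω => by rw [show Y t ω = y from hω]), setIntegral_const, smul_eq_mul] at h1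
    rw [ProbabilityTheory.cond, integral_smul_measure, ← h1, smul_eq_mul, ENNReal.toReal_inv,
      ← mul_assoc, measureReal_def, inv_mul_cancel₀, one_mul]
    exact ENNReal.toReal_ne_zero.2 ⟨h0, measure_ne_top _ _⟩

lemma isPricingRule_of_eq_poissonPrice (hβ : 0 < β) {z : ℝ} (hz : z ∈ lattice δ)
    {p : ℝ → I → ℝ} (hp : ∀ y ∈ lattice δ, ∀ t, p y t = poissonPrice δ β z y t) :
    IsPricingRule δ p where
  mem_Icc y hy t := hp y hy t ▸ poissonPrice_mem_Icc z y t
  strictMono t ht y hy y' hy' hyy' := by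
    simp only [hp y hy t, hp y' hy' t]
    refine skellamTail_lt hz hy' hyy' (mul_pos hβ (Real.toNNReal_pos.2 ?_))
    exact sub_pos.2 ht
  contDiff y hy := by
    obtain ⟨F, hF, hFr⟩ := exists_contDiff_skellamTail δ z y
    have h1 : ContDiff ℝ 1 (fun t : ℝ => F (β * (1 - t))) := by fun_prop
    refine h1.contDiffOn.congr fun t ht => ?_
    rw [IccExtend_of_mem _ _ ht, hp y hy, poissonPrice, hFr]
    have : (0 : ℝ) ≤ 1 - t := sub_nonneg.2 ht.2
    simp [Real.coe_toNNReal _ this]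

lemma IsPricingRule.continuous {p : ℝ → I → ℝ} (hp : IsPricingRule δ p) {y : ℝ}
    (hy : y ∈ lattice δ) : Continuous (p y) := by
  have h1 := continuousOn_iff_continuous_domRestrict.1 (hp.contDiff y hy).continuousOn
  convert h1 using 1
  ext t
  simp [IccExtend_val]

/-- Rationality: the final value of the total demand reveals `v`, and its increments are independent
of the past. -/
lemma IsPoissonDifference.price_ae_eq_condExp [IsProbabilityMeasure μ]
    (h : IsPoissonDifference μ δ β N M Y) {z : ℝ} {v : Ω → ℝ}
    (hv : ∀ᵐ ω ∂μ, v ω = terminalPrice z (Y 1 ω)) (t : I) :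
    (fun ω => poissonPrice δ β z (Y t ω) t) =ᵐ[μ] μ[v | generatedFiltration μ Y t] := by
  have hle := (generatedFiltration μ Y).le t
  have hD : Measurable fun ω => Y 1 ω - Y t ω := (h.measurable 1).sub (h.measurable t)
  have hT : Integrable (fun ω => terminalPrice z (Y 1 ω)) μ := by
    refine Integrable.of_bound
      ((measurable_terminalPrice z).comp (h.measurable 1)).aestronglyMeasurable 1
      (ae_of_all _ fun ω => ?_)
    unfold terminalPrice
    split_ifs <;> simp
  have hg : Measurable[generatedFiltration μ Y t] (fun ω => poissonPrice δ β z (Y t ω) t) :=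
    (measurable_poissonPrice z t).comp (measurable_generatedFiltration h.measurable t)
  have hgi : Integrable (fun ω => poissonPrice δ β z (Y t ω) t) μ := by
    refine Integrable.of_bound (hg.mono hle le_rfl).aestronglyMeasurable 1
      (ae_of_all _ fun ω => ?_)
    have := poissonPrice_mem_Icc (δ := δ) (β := β) z (Y t ω) t
    rw [Real.norm_eq_abs, abs_of_nonneg this.1]
    exact this.2
  refine ae_eq_condExp_of_forall_setIntegral_eq hle (hT.congr ?_) (fun s _ _ => hgi.integrableOn)
    (fun s hs _ => ?_) hg.stronglyMeasurable.aestronglyMeasurable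
  · filter_upwards [hv] with ω hω using hω.symm
  · have hs' := hle s hs
    have h1 := setIntegral_real_of_indep hle hD (h.indep_generatedFiltration t)
      (measurable_generatedFiltration h.measurable t) hs z
    simp only [h.real_tail, add_sub_cancel] at h1
    refine h1.trans (setIntegral_congr_ae hs' ?_)
    filter_upwards [hv] with ω hω _ using hω.symm

end Pricing

/-! ### The profit as an integral at the traded price -/

/-- Every order trades at the price after the trade: the net position `XB - XS` is integrated
against `v - p(Y_t, t)`. -/
lemma profit_eq_jumpIntegral {Ω : Type*} {δ : ℝ} (hδ : 0 < δ) {v : Ω → ℝ}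
    {ZB ZS XB XS : I → Ω → ℝ} (p : ℝ → I → ℝ) {ω : Ω}
    (hZB : IsPointPath δ fun t => ZB t ω) (hZS : IsPointPath δ fun t => ZS t ω)
    (hXB : IsPointPath δ fun t => XB t ω) (hXS : IsPointPath δ fun t => XS t ω)
    (hZ : ∀ t, jump (fun s => ZB s ω) t = 0 ∨ jump (fun s => ZS s ω) t = 0)
    (hX : ∀ t, jump (fun s => XB s ω) t = 0 ∨ jump (fun s => XS s ω) t = 0) :
    profit δ v ZB ZS p XB XS ω =
      jumpIntegral univ (fun t => v ω - p (totalDemand ZB ZS XB XS t ω) t) (fun t => XB t ω) -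
      jumpIntegral univ (fun t => v ω - p (totalDemand ZB ZS XB XS t ω) t)
        (fun t => XS t ω) := by
  classical
  obtain ⟨JB, hpB, hJB, -, -⟩ := hXB.exists_jumps hδ
  obtain ⟨JS, hpS, hJS, -, -⟩ := hXS.exists_jumps hδ
  -- the left limit of the demand in terms of its jump
  have hleft : ∀ t : I, 0 < t →
      Function.leftLim (fun s => totalDemand ZB ZS XB XS s ω) t =
        totalDemand ZB ZS XB XS t ω - (jump (fun s => ZB s ω) t - jump (fun s => ZS s ω) t +
          jump (fun s => XB s ω) t - jump (fun s => XS s ω) t) := by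
    intro t ht
    have := nhdsLT_neBot_of_pos ht
    have h1 := (((hZB.mono.tendsto_leftLim t).sub (hZS.mono.tendsto_leftLim t)).add
      (hXB.mono.tendsto_leftLim t)).sub (hXS.mono.tendsto_leftLim t)
    have h2 : Function.leftLim (fun s => totalDemand ZB ZS XB XS s ω) t = _ :=
      leftLim_eq_of_tendsto h1
    rw [h2]
    simp only [jump, totalDemand, netNoise]
    ring
  unfold profit
  simp only [jumpIntegral_eq_sum hJB, jumpIntegral_eq_sum hJS, mem_univ, if_true, quietTimes,
    jumpTimes, mem_ofPred_eq]
  have hB : ∀ t ∈ JB, (v ω - p (totalDemand ZB ZS XB XS t ω) t) * δ =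
      (if jump (fun s => ZB s ω) t = 0 ∧ jump (fun s => ZS s ω) t = 0 then
        (v ω - p (Function.leftLim (fun s => totalDemand ZB ZS XB XS s ω) t + δ) t) * δ else 0) +
      (if jump (fun s => ZB s ω) t ≠ 0 then
        (v ω - p (Function.leftLim (fun s => totalDemand ZB ZS XB XS s ω) t + 2 * δ) t) * δ
        else 0) +
      (if jump (fun s => ZS s ω) t ≠ 0 then
        (v ω - p (Function.leftLim (fun s => totalDemand ZB ZS XB XS s ω) t) t) * δ else 0) := by
    intro t ht
    have h1 : jump (fun s => XB s ω) t = δ := by rw [hJB, if_pos ht]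
    have h2 : jump (fun s => XS s ω) t = 0 := (hX t).resolve_left (by rw [h1]; exact hδ.ne')
    rw [hleft t (hpB t ht), h1, h2]
    rcases hZB.jumps t with h3 | h3 <;> rcases hZS.jumps t with h4 | h4
    · simp [h3, h4]
    · simp [h3, h4, hδ.ne']
    · simp only [h3, h4, hδ.ne', ne_eq, not_false_eq_true, not_true, and_true, if_true, if_false,
        zero_add, add_zero]
      ring_nf
    · rcases hZ t with h | h
      · exact absurd (h3.symm.trans h) hδ.ne'
      · exact absurd (h4.symm.trans h) hδ.ne'
  have hS : ∀ t ∈ JS, (v ω - p (totalDemand ZB ZS XB XS t ω) t) * δ =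
      (if jump (fun s => ZB s ω) t = 0 ∧ jump (fun s => ZS s ω) t = 0 then
        (v ω - p (Function.leftLim (fun s => totalDemand ZB ZS XB XS s ω) t - δ) t) * δ else 0) +
      (if jump (fun s => ZS s ω) t ≠ 0 then
        (v ω - p (Function.leftLim (fun s => totalDemand ZB ZS XB XS s ω) t - 2 * δ) t) * δ
        else 0) +
      (if jump (fun s => ZB s ω) t ≠ 0 then
        (v ω - p (Function.leftLim (fun s => totalDemand ZB ZS XB XS s ω) t) t) * δ else 0) := by
    intro t ht
    have h1 : jump (fun s => XS s ω) t = δ := by rw [hJS, if_pos ht]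
    have h2 : jump (fun s => XB s ω) t = 0 := (hX t).resolve_right (by rw [h1]; exact hδ.ne')
    rw [hleft t (hpS t ht), h1, h2]
    rcases hZB.jumps t with h3 | h3 <;> rcases hZS.jumps t with h4 | h4
    · simp [h3, h4]
    · simp only [h3, h4, hδ.ne', ne_eq, not_false_eq_true, not_true, and_false, if_true, if_false,
        zero_add, add_zero]
      ring_nf
    · simp [h3, h4, hδ.ne']
    · rcases hZ t with h | h
      · exact absurd (h3.symm.trans h) hδ.ne'
      · exact absurd (h4.symm.trans h) hδ.ne'
  rw [Finset.sum_congr rfl hB, Finset.sum_congr rfl hS]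
  simp only [Finset.sum_add_distrib, sub_sub, add_assoc]
  congr!

/-! ### The insider's problem with perfect foresight of the noise -/

/-- The best profit when the asset pays `v`, the final noise `c` is known, and an order that brings
the position to `x` trades at the price `1` if `z ≤ c + x` and `0` otherwise. -/
noncomputable def foresightProfit (δ z v c : ℝ) : ℝ :=
  if v = 1 then max (z - δ - c) 0 else max (c - z) 0

/-- By convexity of the remaining profit in the position, no sequence of block trades earns more
than `foresightProfit`. -/
lemma gridSum_le_foresightProfit {δ z v c : ℝ} (hδ : 0 ≤ δ) (hv : v = 0 ∨ v = 1) {x : I → ℝ}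
    (h0 : x 0 = 0) (hgap : ∀ t, c + x t < z → c + x t ≤ z - δ) {n : ℕ} (hn : 0 < n) :
    gridSum n (fun t => v - terminalPrice z (c + x t)) x ≤ foresightProfit δ z v c := by
  -- `G` is the profit that remains to be made from a given position
  have key : ∀ G : ℝ → ℝ, (∀ y, 0 ≤ G y) →
      (∀ s t, (v - terminalPrice z (c + x t)) * (x t - x s) ≤ G (x s) - G (x t)) →
      gridSum n (fun t => v - terminalPrice z (c + x t)) x ≤ G 0 := by
    intro G hG h
    calc gridSum n (fun t => v - terminalPrice z (c + x t)) x
        ≤ ∑ i ∈ Finset.range n, (G (x (gridPoint n i)) - G (x (gridPoint n (i + 1)))) :=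
          Finset.sum_le_sum fun i _ => h _ _
      _ = G 0 - G (x 1) := by
          rw [Finset.sum_range_sub' (fun i => G (x (gridPoint n i))), gridPoint_self hn,
            gridPoint_zero, h0]
      _ ≤ G 0 := sub_le_self _ (hG _)
  unfold foresightProfit
  rcases hv with rfl | rfl
  · rw [if_neg zero_ne_one]
    refine (key (fun y => max (c + y - z) 0) (fun y => le_max_right _ _) fun s t => ?_).trans_eq
      (by simp)
    have h1 := le_max_left (c + x s - z) 0
    have h2 := le_max_right (c + x s - z) 0
    unfold terminalPrice
    split_ifs with h
    · rw [max_eq_left (by linarith : 0 ≤ c + x t - z)]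
      linarith
    · rw [max_eq_right (by linarith : c + x t - z ≤ 0)]
      linarith
  · rw [if_pos rfl]
    refine (key (fun y => max (z - δ - c - y) 0) (fun y => le_max_right _ _) fun s t => ?_).trans_eq
      (by simp)
    have h1 := le_max_left (z - δ - c - x s) 0
    have h2 := le_max_right (z - δ - c - x s) 0
    unfold terminalPrice
    split_ifs with h
    · rw [max_eq_right (by linarith : z - δ - c - x t ≤ 0)]
      linarith
    · have h3 := hgap t (not_le.1 h)
      rw [max_eq_left (by linarith : 0 ≤ z - δ - c - x t)]
      linarith

lemma lattice_le_sub_of_lt {δ y z : ℝ} (hδ : 0 < δ) (hy : y ∈ lattice δ) (hz : z ∈ lattice δ)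
    (h : y < z) : y ≤ z - δ := by
  obtain ⟨k, rfl⟩ := hy
  obtain ⟨l, rfl⟩ := hz
  have h1 : (k : ℝ) < l := lt_of_mul_lt_mul_left h hδ.le
  have h2 : (k : ℝ) + 1 ≤ l := by exact_mod_cast h1
  nlinarith

lemma add_mem_lattice {δ y : ℝ} (hy : y ∈ lattice δ) (k : ℤ) : y + δ * k ∈ lattice δ := by
  obtain ⟨l, rfl⟩ := hy
  exact ⟨l + k, by push_cast; ring⟩

lemma continuousWithinAt_comp_of_eventually_eq {x : I → ℝ} {t : I}
    (h : ∀ᶠ s in 𝓝[≥] t, x s = x t) (f : ℝ → ℝ) :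
    ContinuousWithinAt (fun s => f (x s)) (Ici t) t := by
  refine (tendsto_const_nhds (x := f (x t))).congr' ?_
  filter_upwards [h] with s hs
  rw [hs]

/-- If `v = 1`, buying unit by unit up to a final demand of at least `z` attains
`foresightProfit`. -/
lemma tendsto_gridSum_buy {δ z c : ℝ} (hδ : 0 < δ) (hz : z ∈ lattice δ) (hc : c ∈ lattice δ)
    {x : I → ℝ} (hx : IsPointPath δ x) (h1 : z ≤ c + x 1) :
    Tendsto (fun n => gridSum n (fun t => 1 - terminalPrice z (c + x t)) x) atTop
      (𝓝 (foresightProfit δ z 1 c)) := by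
  have hlim := tendsto_gridSum hδ hx (f := fun t => 1 - terminalPrice z (c + x t)) fun t =>
    continuousWithinAt_comp_of_eventually_eq (hx.eventually_eq hδ t)
      (fun y => 1 - terminalPrice z (c + y))
  convert hlim using 2
  obtain ⟨J, -, hJ, -, K, hK, hsum⟩ := hx.exists_jumps hδ
  rw [jumpIntegral_eq_sum hJ]
  simp only [mem_univ, if_true]
  rw [hsum (fun y => (1 - terminalPrice z (c + y)) * δ)]
  have h2 : ∀ k ∈ Finset.range K, (1 - terminalPrice z (c + δ * (k + 1))) * δ =
      max (z - δ - c - δ * (k : ℕ)) 0 - max (z - δ - c - δ * (k + 1 : ℕ)) 0 := by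
    intro k _
    push_cast
    unfold terminalPrice
    split_ifs with h
    · rw [max_eq_right (by linarith), max_eq_right (by linarith)]
      ring
    · have h3 : c + δ * (k + 1) ≤ z - δ := by
        have := add_mem_lattice hc (k + 1)
        push_cast at this
        exact lattice_le_sub_of_lt hδ this hz (not_le.1 h)
      rw [max_eq_left (by linarith), max_eq_left (by linarith)]
      ring
  rw [Finset.sum_congr rfl h2, Finset.sum_range_sub' (fun k : ℕ => max (z - δ - c - δ * k) 0),
    foresightProfit, if_pos rfl, ← hK, max_eq_right (by linarith : z - δ - c - x 1 ≤ 0)]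
  simp

/-- If `v = 0`, selling unit by unit down to a final demand below `z` attains
`foresightProfit`. -/
lemma tendsto_gridSum_sell {δ z c : ℝ} (hδ : 0 < δ) (hz : z ∈ lattice δ) (hc : c ∈ lattice δ)
    {x : I → ℝ} (hx : IsPointPath δ x) (h1 : c - x 1 < z) :
    Tendsto (fun n => gridSum n (fun t => terminalPrice z (c - x t)) x) atTop
      (𝓝 (foresightProfit δ z 0 c)) := by
  have hlim := tendsto_gridSum hδ hx (f := fun t => terminalPrice z (c - x t)) fun t =>
    continuousWithinAt_comp_of_eventually_eq (hx.eventually_eq hδ t)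
      (fun y => terminalPrice z (c - y))
  convert hlim using 2
  obtain ⟨J, -, hJ, -, K, hK, hsum⟩ := hx.exists_jumps hδ
  rw [jumpIntegral_eq_sum hJ]
  simp only [mem_univ, if_true]
  rw [hsum (fun y => terminalPrice z (c - y) * δ)]
  have h2 : ∀ k ∈ Finset.range K, terminalPrice z (c - δ * (k + 1)) * δ =
      max (c - z - δ * (k : ℕ)) 0 - max (c - z - δ * (k + 1 : ℕ)) 0 := by
    intro k _
    push_cast
    unfold terminalPrice
    split_ifs with h
    · rw [max_eq_left (by linarith), max_eq_left (by linarith)]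
      ring
    · have h3 : c - δ * (k + 1) ≤ z - δ := by
        have := add_mem_lattice hc (-(k + 1))
        push_cast at this
        rw [show c + δ * -((k : ℝ) + 1) = c - δ * (k + 1) by ring] at this
        exact lattice_le_sub_of_lt hδ this hz (not_le.1 h)
      rw [max_eq_right (by linarith), max_eq_right (by linarith)]
      ring
  rw [Finset.sum_congr rfl h2, Finset.sum_range_sub' (fun k : ℕ => max (c - z - δ * k) 0),
    foresightProfit, if_neg zero_ne_one, ← hK, max_eq_right (by linarith : c - z - x 1 ≤ 0)]
  simp

section Profits

variable {Ω : Type*} {m : MeasurableSpace Ω} {μ : Measure Ω} {δ : ℝ} {β : ℝ≥0} {v : Ω → ℝ}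
  {ZB ZS XB XS : I → Ω → ℝ} {F : Filtration I m} {p : ℝ → I → ℝ} {z : ℝ}

/-! ### The market -/

lemma IsMarket.measurable_buy (h : IsMarket μ δ β v ZB ZS) (t : I) : Measurable (ZB t) := by
  have := (h.poisson_buy.measurable t).mul_const δ
  simpa [div_mul_cancel₀ _ h.delta_pos.ne'] using this

lemma IsMarket.measurable_sell (h : IsMarket μ δ β v ZB ZS) (t : I) : Measurable (ZS t) := by
  have := (h.poisson_sell.measurable t).mul_const δ
  simpa [div_mul_cancel₀ _ h.delta_pos.ne'] using this

lemma IsMarket.isPoissonDifference (h : IsMarket μ δ β v ZB ZS) :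
    IsPoissonDifference μ δ β (fun t ω => ZB t ω / δ) (fun t ω => ZS t ω / δ) (netNoise ZB ZS) :=
  .of_div h.delta_pos (fun t => (h.measurable_buy t).sub (h.measurable_sell t)) h.poisson_buy
    h.poisson_sell h.indep_noise (ae_of_all _ fun _ _ => rfl)

/-- The fundamental value is independent of the whole path of the noise. -/
lemma IsMarket.indep_value [IsProbabilityMeasure μ] (h : IsMarket μ δ β v ZB ZS) :
    Indep (MeasurableSpace.comap v inferInstance)
      (generatedFiltration μ (netNoise ZB ZS) 1) μ := by
  have h1 : generatedFiltration μ (netNoise ZB ZS) 1 = completedNatural μ (netNoise ZB ZS) 1 :=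
    Filtration.rightCont_eq_of_isMax (i := (1 : I)) _ isMax_top
  have h2 := h.indep_v
  rw [IndepFun_iff_Indep] at h2
  rw [h1]
  refine (indep_of_indep_of_le_left (indep_eventually_left h2) ?_).symm
  refine (h.isPoissonDifference.completedNatural_le 1).trans ?_
  have h3 : pastIncrements (fun t ω => ZB t ω / δ) 1 ⊔ pastIncrements (fun t ω => ZS t ω / δ) 1 ≤
      MeasurableSpace.comap (fun ω => ((fun t => ZB t ω), (fun t => ZS t ω))) inferInstance := by
    refine sup_le ((pastIncrements_le_comap_path _ 1).trans ?_)
      ((pastIncrements_le_comap_path _ 1).trans ?_)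
    · rw [show (fun ω t => ZB t ω / δ) = (fun (q : (I → ℝ) × (I → ℝ)) t => q.1 t / δ) ∘
        (fun ω => ((fun t => ZB t ω), (fun t => ZS t ω))) from rfl, ← MeasurableSpace.comap_comp]
      exact MeasurableSpace.comap_mono (Measurable.comap_le (by fun_prop))
    · rw [show (fun ω t => ZS t ω / δ) = (fun (q : (I → ℝ) × (I → ℝ)) t => q.2 t / δ) ∘
        (fun ω => ((fun t => ZB t ω), (fun t => ZS t ω))) from rfl, ← MeasurableSpace.comap_comp]
      exact MeasurableSpace.comap_mono (Measurable.comap_le (by fun_prop))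
  rintro s ⟨t, ht, hst⟩
  exact ⟨t, h3 t ht, hst⟩

/-- The insider does not know the future increments of the noise. -/
lemma IsInsiderFiltration.indep_increment [IsProbabilityMeasure μ]
    (hF : IsInsiderFiltration μ v (netNoise ZB ZS) F) (h : IsMarket μ δ β v ZB ZS) (t : I) :
    Indep (F t) (MeasurableSpace.comap (fun ω => netNoise ZB ZS 1 ω - netNoise ZB ZS t ω)
      inferInstance) μ := by
  obtain ⟨H, hH, hgen⟩ := hF.generated
  set G := generatedFiltration μ (netNoise ZB ZS)
  have hZ := h.isPoissonDifference
  have hD : Measurable[G 1] (fun ω => netNoise ZB ZS 1 ω - netNoise ZB ZS t ω) :=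
    Measurable.sub (measurable_generatedFiltration hZ.measurable 1)
      ((measurable_generatedFiltration hZ.measurable t).mono (G.mono le_top) le_rfl)
  have hDle := hD.comap_le
  have hv := h.measurable_v.comap_le
  have h1 : Indep (MeasurableSpace.comap v inferInstance ⊔ G t) (MeasurableSpace.comap
      (fun ω => netNoise ZB ZS 1 ω - netNoise ZB ZS t ω) inferInstance) μ :=
    indep_sup_left hv (G.le t) (hDle.trans (G.le 1))
      (indep_of_indep_of_le_right h.indep_value (sup_le (G.mono le_top) hDle))
      (hZ.indep_generatedFiltration t)
  rw [hgen t, sup_comm]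
  refine indep_sup_left (H.le t) (sup_le hv (G.le t)) (hDle.trans (G.le 1)) ?_ h1
  refine indep_of_indep_of_le hH (H.mono le_top) ?_
  exact sup_le (sup_le_sup_left (G.mono le_top) _) (hDle.trans le_sup_right)

lemma IsInsiderFiltration.comap_value_le (hF : IsInsiderFiltration μ v (netNoise ZB ZS) F)
    (t : I) : MeasurableSpace.comap v inferInstance ≤ F t := by
  obtain ⟨H, -, hgen⟩ := hF.generated
  rw [hgen t]
  exact le_sup_left.trans le_sup_left

lemma IsInsiderFiltration.measurable_noise (hF : IsInsiderFiltration μ v (netNoise ZB ZS) F)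
    (hZ : ∀ t, Measurable (netNoise ZB ZS t)) (t : I) :
    Measurable[F t] (netNoise ZB ZS t) := by
  obtain ⟨H, -, hgen⟩ := hF.generated
  refine (measurable_generatedFiltration (μ := μ) hZ t).mono ?_ le_rfl
  rw [hgen t]
  exact le_sup_right.trans le_sup_left

/-! ### Expected profits -/

/-- The Riemann sum of the profit on the grid of mesh `1 / n`. -/
noncomputable def gridProfit (δ : ℝ) (β : ℝ≥0) (z : ℝ) (v : Ω → ℝ) (ZB ZS XB XS : I → Ω → ℝ)
    (n : ℕ) (ω : Ω) : ℝ :=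
  gridSum n (fun t => v ω - poissonPrice δ β z (totalDemand ZB ZS XB XS t ω) t)
    (fun t => XB t ω - XS t ω)

/-- The same Riemann sum with the price at time `t` replaced by the final price that would result if
the insider stopped trading at `t`. -/
noncomputable def gridForesight (z : ℝ) (v : Ω → ℝ) (ZB ZS XB XS : I → Ω → ℝ)
    (n : ℕ) (ω : Ω) : ℝ :=
  gridSum n (fun t => v ω - terminalPrice z (netNoise ZB ZS 1 ω + (XB t ω - XS t ω)))
    (fun t => XB t ω - XS t ω)

lemma IsOrderProcess.measurable {X : I → Ω → ℝ} (h : IsOrderProcess μ δ F X) (t : I) :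
    Measurable[F t] (X t) := (h.adapted t).measurable

lemma IsOrderProcess.measurable' {X : I → Ω → ℝ} (h : IsOrderProcess μ δ F X) (t : I) :
    Measurable (X t) := (h.measurable t).mono (F.le t) le_rfl

lemma IsOrderProcess.integrable_increment {X : I → Ω → ℝ} (h : IsOrderProcess μ δ F X)
    (s t : I) : Integrable (fun ω => X t ω - X s ω) μ := by
  refine h.integrable.mono ((h.measurable' t).sub (h.measurable' s)).aestronglyMeasurable ?_
  filter_upwards [h.path] with ω hω
  have h1 := hω.nonneg
  have h2 : X s ω ≤ X 1 ω := hω.mono (show s ≤ 1 from le_top)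
  have h3 : X t ω ≤ X 1 ω := hω.mono (show t ≤ 1 from le_top)
  rw [Real.norm_eq_abs, Real.norm_eq_abs, abs_of_nonneg (h1 1), abs_le]
  constructor <;> linarith [h1 s, h1 t]

lemma abs_gridSum_sub_le (hX : IsAdmissible μ δ v ZB ZS XB XS F) :
    ∀ᵐ ω ∂μ, ∀ (n : ℕ) (f : I → ℝ), (∀ t, |f t| ≤ 1) →
      |gridSum n f (fun t => XB t ω - XS t ω)| ≤ XB 1 ω + XS 1 ω := by
  filter_upwards [hX.buy.path, hX.sell.path] with ω h1 h2 n f hf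
  rw [gridSum_sub_right]
  exact (abs_sub _ _).trans
    (add_le_add (abs_gridSum_le n h1.mono h1.zero hf) (abs_gridSum_le n h2.mono h2.zero hf))

lemma IsMarket.abs_sub_le (h : IsMarket μ δ β v ZB ZS) (ω : Ω) {q : ℝ} (hq : q ∈ Icc (0 : ℝ) 1) :
    |v ω - q| ≤ 1 := by
  rw [abs_le]
  rcases h.values_v ω with hv | hv <;> rw [hv] <;> constructor <;> linarith [hq.1, hq.2]

lemma terminalPrice_mem_Icc (z y : ℝ) : terminalPrice z y ∈ Icc (0 : ℝ) 1 := by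
  unfold terminalPrice
  split_ifs <;> simp

lemma totalDemand_path (h : IsMarket μ δ β v ZB ZS) (hX : IsAdmissible μ δ v ZB ZS XB XS F) :
    ∀ᵐ ω ∂μ, ∀ t, totalDemand ZB ZS XB XS t ω ∈ lattice δ ∧
      netNoise ZB ZS 1 ω + (XB t ω - XS t ω) ∈ lattice δ ∧
      ∀ᶠ s in 𝓝[≥] t, totalDemand ZB ZS XB XS s ω = totalDemand ZB ZS XB XS t ω := by
  filter_upwards [h.isPoissonDifference.path, hX.buy.path, hX.sell.path] with ω h1 h2 h3 t
  obtain ⟨a, ha⟩ := h2.values t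
  obtain ⟨b, hb⟩ := h3.values t
  have hx : XB t ω - XS t ω = δ * ((a - b : ℤ) : ℝ) := by
    rw [ha, hb]; push_cast; ring
  refine ⟨?_, ?_, ?_⟩
  · rw [totalDemand, add_sub_assoc, hx]
    exact add_mem_lattice (h1 t).1 _
  · rw [hx]
    exact add_mem_lattice (h1 1).1 _
  · filter_upwards [(h1 t).2, h2.eventually_eq h.delta_pos t, h3.eventually_eq h.delta_pos t]
      with s h4 h5 h6
    rw [totalDemand, totalDemand, h4, h5, h6]

lemma tendsto_gridProfit (h : IsMarket μ δ β v ZB ZS) (hX : IsAdmissible μ δ v ZB ZS XB XS F)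
    (hz : z ∈ lattice δ) (hp : ∀ y ∈ lattice δ, ∀ t, p y t = poissonPrice δ β z y t)
    [IsProbabilityMeasure μ] :
    ∀ᵐ ω ∂μ, Tendsto (fun n => gridProfit δ β z v ZB ZS XB XS n ω) atTop
      (𝓝 (profit δ v ZB ZS p XB XS ω)) := by
  have hrule := isPricingRule_of_eq_poissonPrice h.beta_pos hz hp
  filter_upwards [h.poisson_buy.path, h.poisson_sell.path, hX.buy.path, hX.sell.path,
    hX.no_opposite, totalDemand_path h hX,
    ae_no_common_jump h.poisson_buy h.poisson_sell h.isPoissonDifference.indep]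
    with ω hB hS hXB hXS hno hY hZ
  have hB' := hB.of_div h.delta_pos
  have hS' := hS.of_div h.delta_pos
  rw [profit_eq_jumpIntegral h.delta_pos p hB' hS' hXB hXS ?_ hno]
  · have hf : ∀ t, ContinuousWithinAt
        (fun t => v ω - p (totalDemand ZB ZS XB XS t ω) t) (Ici t) t := by
      intro t
      refine ContinuousWithinAt.sub continuousWithinAt_const ?_
      have h1 := (hrule.continuous (hY t).1).continuousWithinAt (s := Ici t) (x := t)
      refine h1.tendsto.congr' ?_
      filter_upwards [(hY t).2.2] with s hs
      rw [hs]
    refine ((tendsto_gridSum h.delta_pos hXB hf).sub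
      (tendsto_gridSum h.delta_pos hXS hf)).congr fun n => ?_
    rw [← gridSum_sub_right, gridProfit]
    congr 1
    ext t
    rw [hp _ (hY t).1]
  · intro t
    refine (hZ t).imp (fun h1 => ?_) fun h1 => ?_
    · rw [jump_div δ hB'.mono] at h1
      exact (div_eq_zero_iff.1 h1).resolve_right h.delta_pos.ne'
    · rw [jump_div δ hS'.mono] at h1
      exact (div_eq_zero_iff.1 h1).resolve_right h.delta_pos.ne'

lemma measurable_gridProfit (h : IsMarket μ δ β v ZB ZS) (hX : IsAdmissible μ δ v ZB ZS XB XS F)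
    (n : ℕ) : Measurable (gridProfit δ β z v ZB ZS XB XS n) := by
  have hB := hX.buy.measurable'
  have hS := hX.sell.measurable'
  have hZ := h.isPoissonDifference.measurable
  have hv := h.measurable_v
  have hq : ∀ t, Measurable fun ω => poissonPrice δ β z (totalDemand ZB ZS XB XS t ω) t :=
    fun t => (measurable_poissonPrice z t).comp (((hZ t).add (hB t)).sub (hS t))
  unfold gridProfit gridSum
  fun_prop

lemma measurable_gridForesight (h : IsMarket μ δ β v ZB ZS)
    (hX : IsAdmissible μ δ v ZB ZS XB XS F) (n : ℕ) :
    Measurable (gridForesight z v ZB ZS XB XS n) := by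
  have hB := hX.buy.measurable'
  have hS := hX.sell.measurable'
  have hZ := h.isPoissonDifference.measurable
  have hv := h.measurable_v
  have hq : ∀ t, Measurable fun ω =>
      terminalPrice z (netNoise ZB ZS 1 ω + (XB t ω - XS t ω)) :=
    fun t => (measurable_terminalPrice z).comp ((hZ 1).add ((hB t).sub (hS t)))
  unfold gridForesight gridSum
  fun_prop

lemma abs_gridProfit_le (h : IsMarket μ δ β v ZB ZS) (hX : IsAdmissible μ δ v ZB ZS XB XS F) :
    ∀ᵐ ω ∂μ, ∀ n, |gridProfit δ β z v ZB ZS XB XS n ω| ≤ XB 1 ω + XS 1 ω := by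
  filter_upwards [abs_gridSum_sub_le hX] with ω hω n
  exact hω n _ fun t => h.abs_sub_le ω (poissonPrice_mem_Icc _ _ _)

lemma abs_gridForesight_le (h : IsMarket μ δ β v ZB ZS)
    (hX : IsAdmissible μ δ v ZB ZS XB XS F) :
    ∀ᵐ ω ∂μ, ∀ n, |gridForesight z v ZB ZS XB XS n ω| ≤ XB 1 ω + XS 1 ω := by
  filter_upwards [abs_gridSum_sub_le hX] with ω hω n
  exact hω n _ fun t => h.abs_sub_le ω (terminalPrice_mem_Icc _ _)

lemma IsAdmissible.integrable_bound (hX : IsAdmissible μ δ v ZB ZS XB XS F) :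
    Integrable (fun ω => XB 1 ω + XS 1 ω) μ := hX.buy.integrable.add hX.sell.integrable

lemma integrable_gridForesight (h : IsMarket μ δ β v ZB ZS)
    (hX : IsAdmissible μ δ v ZB ZS XB XS F) (n : ℕ) :
    Integrable (gridForesight z v ZB ZS XB XS n) μ := by
  refine hX.integrable_bound.mono' (measurable_gridForesight h hX n).aestronglyMeasurable ?_
  filter_upwards [abs_gridForesight_le (z := z) h hX] with ω hω using hω n

lemma integrable_profit [IsProbabilityMeasure μ] (h : IsMarket μ δ β v ZB ZS)
    (hX : IsAdmissible μ δ v ZB ZS XB XS F) (hz : z ∈ lattice δ)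
    (hp : ∀ y ∈ lattice δ, ∀ t, p y t = poissonPrice δ β z y t) :
    Integrable (profit δ v ZB ZS p XB XS) μ := by
  have hlim := tendsto_gridProfit h hX hz hp
  refine hX.integrable_bound.mono' (aestronglyMeasurable_of_tendsto_ae atTop
    (fun n => (measurable_gridProfit h hX n).aestronglyMeasurable) hlim) ?_
  filter_upwards [hlim, abs_gridProfit_le (z := z) h hX] with ω h1 h2
  exact le_of_tendsto h1.norm (Eventually.of_forall h2)

/-- The future noise increment may be integrated out at each grid point: it is independent of all
the insider knows, and the traded price is the resulting average of the final price. -/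
lemma setIntegral_gridProfit [IsProbabilityMeasure μ] (h : IsMarket μ δ β v ZB ZS)
    (hX : IsAdmissible μ δ v ZB ZS XB XS F) {s : Set Ω}
    (hs : MeasurableSet[MeasurableSpace.comap v inferInstance] s) (n : ℕ) :
    ∫ ω in s, gridProfit δ β z v ZB ZS XB XS n ω ∂μ =
      ∫ ω in s, gridForesight z v ZB ZS XB XS n ω ∂μ := by
  have hZ := h.isPoissonDifference
  have hs' : MeasurableSet s := h.measurable_v.comap_le s hs
  have hB := hX.buy.measurable'
  have hS := hX.sell.measurable'
  -- a weight with values in `[0,1]` keeps the increments of the position integrable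
  have hint : ∀ (i : ℕ) (q : Ω → ℝ), Measurable q → (∀ ω, q ω ∈ Icc (0 : ℝ) 1) →
      Integrable (fun ω => q ω *
        ((XB (gridPoint n (i + 1)) ω - XS (gridPoint n (i + 1)) ω) -
          (XB (gridPoint n i) ω - XS (gridPoint n i) ω))) μ := by
    intro i q hq hq1
    have h1 := (hX.buy.integrable_increment (gridPoint n i) (gridPoint n (i + 1))).sub
      (hX.sell.integrable_increment (gridPoint n i) (gridPoint n (i + 1)))
    refine Integrable.bdd_mul (c := 1) (h1.congr (ae_of_all _ fun ω => ?_))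
      hq.aestronglyMeasurable (ae_of_all _ fun ω => ?_)
    · simp only [Pi.sub_apply]
      ring
    · rw [Real.norm_eq_abs, abs_of_nonneg (hq1 ω).1]
      exact (hq1 ω).2
  have hv01 : ∀ ω, v ω ∈ Icc (0 : ℝ) 1 := fun ω => by
    rcases h.values_v ω with hv | hv <;> simp [hv]
  have hq1 : ∀ t, Measurable fun ω => poissonPrice δ β z (totalDemand ZB ZS XB XS t ω) t := fun t =>
    (measurable_poissonPrice z _).comp (((hZ.measurable t).add (hB t)).sub (hS t))
  have hq2 : ∀ t, Measurable fun ω =>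
      terminalPrice z (netNoise ZB ZS 1 ω + (XB t ω - XS t ω)) := fun t =>
    (measurable_terminalPrice z).comp ((hZ.measurable 1).add ((hB t).sub (hS t)))
  have hi1 := fun i => (hint i _ h.measurable_v hv01).sub
    (hint i _ (hq1 (gridPoint n (i + 1))) fun ω => poissonPrice_mem_Icc _ _ _)
  have hi2 := fun i => (hint i _ h.measurable_v hv01).sub
    (hint i _ (hq2 (gridPoint n (i + 1))) fun ω => terminalPrice_mem_Icc _ _)
  unfold gridProfit gridForesight gridSum
  simp only [sub_mul (v _)]
  rw [integral_finsetSum, integral_finsetSum]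
  rotate_left
  · exact fun i _ => (hi2 i).integrableOn
  · exact fun i _ => (hi1 i).integrableOn
  refine Finset.sum_congr rfl fun i _ => ?_
  rw [integral_sub (hint i _ h.measurable_v hv01).integrableOn
      (hint i _ (hq1 (gridPoint n (i + 1))) fun ω => poissonPrice_mem_Icc _ _ _).integrableOn,
    integral_sub (hint i _ h.measurable_v hv01).integrableOn
      (hint i _ (hq2 (gridPoint n (i + 1))) fun ω => terminalPrice_mem_Icc _ _).integrableOn]
  congr 1
  -- the weight `W` and the demand at the grid point `u` are known to the insider
  set u := gridPoint n (i + 1)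
  set u' := gridPoint n i
  have hu : F u' ≤ F u := F.mono (gridPoint_mono n (Nat.le_succ i))
  have hXm : Measurable[F u] fun ω => XB u ω - XS u ω :=
    Measurable.sub (hX.buy.measurable u) (hX.sell.measurable u)
  have hXm' : Measurable[F u] fun ω => XB u' ω - XS u' ω :=
    Measurable.sub ((hX.buy.measurable u').mono hu le_rfl)
      ((hX.sell.measurable u').mono hu le_rfl)
  have hWm : Measurable[F u] (s.indicator fun ω => (XB u ω - XS u ω) - (XB u' ω - XS u' ω)) :=
    Measurable.indicator (Measurable.sub hXm hXm') (hX.filtration.comap_value_le u s hs)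
  have hUm : Measurable[F u] (totalDemand ZB ZS XB XS u) :=
    Measurable.sub (Measurable.add (hX.filtration.measurable_noise hZ.measurable u)
      (hX.buy.measurable u)) (hX.sell.measurable u)
  have hWi : Integrable
      (s.indicator fun ω => (XB u ω - XS u ω) - (XB u' ω - XS u' ω)) μ := by
    refine Integrable.indicator ?_ hs'
    have := hint i (fun _ => 1) measurable_const (fun _ => by simp)
    simpa using this
  have key := integral_mul_real_of_indep (F.le u) ((hZ.measurable 1).sub (hZ.measurable u))
    (hX.filtration.indep_increment h u) hWm hUm hWi z
  simp only [Pi.sub_apply] at key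
  simp only [hZ.real_tail] at key
  rw [← integral_indicator hs', ← integral_indicator hs']
  refine Eq.trans (integral_congr_ae (ae_of_all _ fun ω => ?_))
    (key.trans (integral_congr_ae (ae_of_all _ fun ω => ?_)))
  · by_cases hω : ω ∈ s <;> simp [hω, poissonPrice, mul_comm]
  · have : totalDemand ZB ZS XB XS u ω + (netNoise ZB ZS 1 ω - netNoise ZB ZS u ω) =
        netNoise ZB ZS 1 ω + (XB u ω - XS u ω) := by
      simp only [totalDemand]; ring
    by_cases hω : ω ∈ s <;> simp [hω, this, mul_comm]

lemma tendsto_setIntegral_gridForesight [IsProbabilityMeasure μ] (h : IsMarket μ δ β v ZB ZS)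
    (hX : IsAdmissible μ δ v ZB ZS XB XS F) (hz : z ∈ lattice δ)
    (hp : ∀ y ∈ lattice δ, ∀ t, p y t = poissonPrice δ β z y t) {s : Set Ω}
    (hs : MeasurableSet[MeasurableSpace.comap v inferInstance] s) :
    Tendsto (fun n => ∫ ω in s, gridForesight z v ZB ZS XB XS n ω ∂μ) atTop
      (𝓝 (∫ ω in s, profit δ v ZB ZS p XB XS ω ∂μ)) := by
  refine (tendsto_integral_of_dominated_convergence (fun ω => XB 1 ω + XS 1 ω)
    (fun n => (measurable_gridProfit (z := z) h hX n).aestronglyMeasurable)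
    hX.integrable_bound.integrableOn (fun n => ?_)
    (ae_restrict_of_ae (tendsto_gridProfit h hX hz hp))).congr fun n =>
      setIntegral_gridProfit h hX hs n
  refine ae_restrict_of_ae ?_
  filter_upwards [abs_gridProfit_le (z := z) h hX] with ω hω using hω n

/-- No admissible strategy beats perfect foresight of the noise. -/
lemma setIntegral_profit_le [IsProbabilityMeasure μ] (h : IsMarket μ δ β v ZB ZS)
    (hX : IsAdmissible μ δ v ZB ZS XB XS F) (hz : z ∈ lattice δ)
    (hp : ∀ y ∈ lattice δ, ∀ t, p y t = poissonPrice δ β z y t)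
    (hR : Integrable (fun ω => foresightProfit δ z (v ω) (netNoise ZB ZS 1 ω)) μ) {s : Set Ω}
    (hs : MeasurableSet[MeasurableSpace.comap v inferInstance] s) :
    ∫ ω in s, profit δ v ZB ZS p XB XS ω ∂μ ≤
      ∫ ω in s, foresightProfit δ z (v ω) (netNoise ZB ZS 1 ω) ∂μ := by
  refine le_of_tendsto (tendsto_setIntegral_gridForesight h hX hz hp hs) ?_
  filter_upwards [eventually_gt_atTop 0] with n hn
  refine integral_mono_ae (integrable_gridForesight h hX n).integrableOn hR.integrableOn ?_
  refine ae_restrict_of_ae ?_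
  filter_upwards [totalDemand_path h hX, hX.buy.path, hX.sell.path] with ω h1 h2 h3
  have h4 : XB 0 ω = 0 := h2.zero
  have h5 : XS 0 ω = 0 := h3.zero
  exact gridSum_le_foresightProfit h.delta_pos.le (h.values_v ω) (by simp [h4, h5])
    (fun t ht => lattice_le_sub_of_lt h.delta_pos (h1 t).2.1 hz ht) hn

/-- A strategy that only trades in the direction of `v`, and ends on the right side of `z`, is as
good as perfect foresight of the noise. -/
lemma tendsto_gridForesight (h : IsMarket μ δ β v ZB ZS)
    (hX : IsAdmissible μ δ v ZB ZS XB XS F) (hz : z ∈ lattice δ)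
    (hend : ∀ᵐ ω ∂μ, z ≤ totalDemand ZB ZS XB XS 1 ω ↔ v ω = 1)
    (hXS : ∀ᵐ ω ∂μ, v ω = 1 → ∀ t, XS t ω = 0) (hXB : ∀ᵐ ω ∂μ, v ω = 0 → ∀ t, XB t ω = 0) :
    ∀ᵐ ω ∂μ, Tendsto (fun n => gridForesight z v ZB ZS XB XS n ω) atTop
      (𝓝 (foresightProfit δ z (v ω) (netNoise ZB ZS 1 ω))) := by
  filter_upwards [h.isPoissonDifference.path, hX.buy.path, hX.sell.path, hend, hXS, hXB]
    with ω h1 h2 h3 h4 h5 h6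
  rcases h.values_v ω with hv | hv
  · have h7 : ¬ z ≤ totalDemand ZB ZS XB XS 1 ω := by rw [h4, hv]; exact zero_ne_one
    have h8 := h6 hv
    simp only [totalDemand, h8, add_zero, not_le] at h7
    have := tendsto_gridSum_sell h.delta_pos hz (h1 1).1 h3 h7
    rw [hv]
    refine this.congr fun n => ?_
    simp only [gridForesight, h8, hv, gridSum, zero_sub]
    refine Finset.sum_congr rfl fun i _ => ?_
    rw [← sub_eq_add_neg]
    ring
  · have h7 : z ≤ totalDemand ZB ZS XB XS 1 ω := h4.2 hv
    have h8 := h5 hv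
    simp only [totalDemand, h8, sub_zero] at h7
    have := tendsto_gridSum_buy h.delta_pos hz (h1 1).1 h2 h7
    rw [hv]
    refine this.congr fun n => ?_
    simp only [gridForesight, h8, hv, sub_zero]

/-- Comparison of conditional expectations through integrals over events of the smaller
σ-algebra. -/
lemma condExp_le_condExp_of_setIntegral_le {m' : MeasurableSpace Ω} (hm : m' ≤ m)
    [IsProbabilityMeasure μ] {f g : Ω → ℝ} (hf : Integrable f μ) (hg : Integrable g μ)
    (h : ∀ s, MeasurableSet[m'] s → ∫ ω in s, f ω ∂μ ≤ ∫ ω in s, g ω ∂μ) :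
    μ[f | m'] ≤ᵐ[μ] μ[g | m'] := by
  refine ae_le_of_ae_le_trim (hm := hm) ?_
  refine ae_le_of_forall_setIntegral_le
    (integrable_condExp.trim hm stronglyMeasurable_condExp)
    (integrable_condExp.trim hm stronglyMeasurable_condExp) fun s hs _ => ?_
  rw [← setIntegral_trim hm stronglyMeasurable_condExp hs,
    ← setIntegral_trim hm stronglyMeasurable_condExp hs, setIntegral_condExp hm hf hs,
    setIntegral_condExp hm hg hs]
  exact h s hs

lemma isOptimalStrategy [IsProbabilityMeasure μ] (h : IsMarket μ δ β v ZB ZS)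
    (hX : IsAdmissible μ δ v ZB ZS XB XS F) (hz : z ∈ lattice δ)
    (hp : ∀ y ∈ lattice δ, ∀ t, p y t = poissonPrice δ β z y t)
    (hend : ∀ᵐ ω ∂μ, z ≤ totalDemand ZB ZS XB XS 1 ω ↔ v ω = 1)
    (hXS : ∀ᵐ ω ∂μ, v ω = 1 → ∀ t, XS t ω = 0) (hXB : ∀ᵐ ω ∂μ, v ω = 0 → ∀ t, XB t ω = 0) :
    IsOptimalStrategy μ δ v ZB ZS p XB XS F := by
  have hlim := tendsto_gridForesight h hX hz hend hXS hXB
  have hR : Integrable (fun ω => foresightProfit δ z (v ω) (netNoise ZB ZS 1 ω)) μ := by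
    refine hX.integrable_bound.mono' (aestronglyMeasurable_of_tendsto_ae atTop
      (fun n => (measurable_gridForesight h hX n).aestronglyMeasurable) hlim) ?_
    filter_upwards [hlim, abs_gridForesight_le (z := z) h hX] with ω h1 h2
    exact le_of_tendsto h1.norm (Eventually.of_forall h2)
  refine ⟨hX, integrable_profit h hX hz hp, fun XB' XS' F' hX' =>
    ⟨integrable_profit h hX' hz hp, ?_⟩⟩
  refine condExp_le_condExp_of_setIntegral_le h.measurable_v.comap_le
    (integrable_profit h hX' hz hp) (integrable_profit h hX hz hp) fun s hs => ?_
  refine (setIntegral_profit_le h hX' hz hp hR hs).trans_eq ?_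
  refine tendsto_nhds_unique ?_ (tendsto_setIntegral_gridForesight h hX hz hp hs)
  refine tendsto_integral_of_dominated_convergence (fun ω => XB 1 ω + XS 1 ω)
    (fun n => (measurable_gridForesight h hX n).aestronglyMeasurable)
    hX.integrable_bound.integrableOn (fun n => ae_restrict_of_ae ?_) (ae_restrict_of_ae hlim)
  filter_upwards [abs_gridForesight_le (z := z) h hX] with ω hω using hω n

end Profits

end GlostenMilgrom

open GlostenMilgrom in
theorem mainTheorem4 {Ω : Type*} {m : MeasurableSpace Ω} (μ : Measure Ω)
    [IsProbabilityMeasure μ] [μ.IsComplete]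
    (δ : ℝ) (β : ℝ≥0) (v : Ω → ℝ) (ZB ZS : I → Ω → ℝ)
    (market : IsMarket μ δ β v ZB ZS)
    (p : ℝ → I → ℝ) (XB XS : I → Ω → ℝ) (FI : Filtration I m)
    (h : ∃ yδ ∈ lattice δ,
      (∀ᵐ ω ∂μ, yδ ≤ totalDemand ZB ZS XB XS 1 ω ↔ v ω = 1) ∧
      (∀ y ∈ lattice δ, ∀ t : I, p y t = markovPrice μ (netNoise ZB ZS) yδ y t) ∧
      IsAdmissible μ δ v ZB ZS XB XS FI ∧
      (∃ YB YS : I → Ω → ℝ,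
        (∀ᵐ ω ∂μ, ∀ t, totalDemand ZB ZS XB XS t ω = YB t ω - YS t ω) ∧
        StronglyAdapted (generatedFiltration μ (totalDemand ZB ZS XB XS)) YB ∧
        StronglyAdapted (generatedFiltration μ (totalDemand ZB ZS XB XS)) YS ∧
        IsPoissonProcess μ β (fun t ω => YB t ω / δ) ∧
        IsPoissonProcess μ β (fun t ω => YS t ω / δ) ∧
        IndepProcesses μ YB YS) ∧
      (∀ᵐ ω ∂μ, v ω = 1 → ∀ t, XS t ω = 0) ∧
      (∀ᵐ ω ∂μ, v ω = 0 → ∀ t, XB t ω = 0)) :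
    IsEquilibrium μ δ v ZB ZS p XB XS FI := by
  obtain ⟨z, hz, hend, hp, hX, ⟨YB, YS, hY, -, -, hYB, hYS, hYind⟩, hXS, hXB⟩ := h
  have hp' : ∀ y ∈ lattice δ, ∀ t, p y t = poissonPrice δ β z y t := fun y hy t =>
    (hp y hy t).trans (market.isPoissonDifference.markovPrice_eq z y t)
  have hYm : ∀ t, Measurable (totalDemand ZB ZS XB XS t) := fun t =>
    ((market.isPoissonDifference.measurable t).add (hX.buy.measurable' t)).sub
      (hX.sell.measurable' t)
  have hYd := IsPoissonDifference.of_div market.delta_pos hYm hYB hYS hYind hY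
  refine ⟨⟨isPricingRule_of_eq_poissonPrice market.beta_pos hz hp', fun t => ?_⟩,
    isOptimalStrategy market hX hz hp' hend hXS hXB⟩
  have hv : ∀ᵐ ω ∂μ, v ω = terminalPrice z (totalDemand ZB ZS XB XS 1 ω) := by
    filter_upwards [hend] with ω hω
    unfold terminalPrice
    split_ifs with h1
    · exact hω.1 h1
    · exact (market.values_v ω).resolve_right fun h2 => h1 (hω.2 h2)
  refine EventuallyEq.trans ?_ (hYd.price_ae_eq_condExp hv t)
  filter_upwards [totalDemand_path market hX] with ω hω
  exact hp' _ (hω t).1 t
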